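/- All manifolds are smooth ($C^\infty$), finite dimensional, Hausdorff, second countable and without boundary. Let $\pi:M\to N$ be a fibred manifold (a smooth surjective submersion), let $T_MN=TN\times_N M$ with projections $\pi_1:T_MN\to TN$, $\pi_2:T_MN\to M$, let $T^*_MN=T^*N\times_N M$ with projection $\overline\pi_1:T^*_MN\to T^*N$, and let $p_1=(T\pi,\tau_M):TM\to T_MN$, where $\tau_M:TM\to M$ is the tangent bundle projection. Let $L$ be a smooth function on $T_MN$ and $\beta$ a smooth closed 2-form on $M$, and let $F:TM\to T^*M$ be the associated gyroscopic force term $F(v_m)=-i_{v_m}\beta_m$. Fix $a<b$ and $I=[a,b]$. A smooth curve $m:I\to M$ is a *critical curve* of the intrinsically constrained Lagrangian system $(\pi:M\to N,L,F)$ if $$\left.\frac{d}{d\epsilon}\right|_{\epsilon=0}\int_I L\big(p_1(\dot m_\epsilon(t))\big)\,dt+\int_I\langle F(\dot m(t)),\delta m(t)\rangle\,dt=0$$ for every smooth deformation $m_\epsilon$ of $m=m_0$ with fixed end points, where $\delta m=\frac{d}{d\epsilon}|_{\epsilon=0}m_\epsilon$. Let $\mathbb{F}_1L:T_MN\to T^*_MN$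 be the Legendre map $\langle\mathbb{F}_1L(v_n,m),(w_n,m)\rangle=\frac{d}{d\epsilon}|_{\epsilon=0}L(v_n+\epsilon w_n,m)$, let $E_L(v_n,m)=\langle\mathbb{F}_1L(v_n,m),(v_n,m)\rangle-L(v_n,m)$ be the energy, and let $\omega_N=d\theta_N$, with $\theta_N$ the Liouville 1-form on $T^*N$. **Proposition.** (1) If $m:I\to M$ is a critical curve of $(\pi:M\to N,L,F)$ and $n=\pi\circ m$, then the curve $\gamma(t)=(\dot n(t),m(t))$ in $T_MN$ satisfies, for all $t\in I$, $$i_{\dot\gamma(t)}\big((\overline\pi_1\circ\mathbb{F}_1L)^*\omega_N+\pi_2^*\beta\big)=-dE_L\quad\text{at }\gamma(t).$$ (2) Conversely, if $\gamma:I\to T_MN$ is a smooth curve of the form $\gamma(t)=(\dot n(t),m(t))$ with $m=\pi_2\circ\gamma$ and $n=\pi\circ m$, and $\gamma$ satisfies this equation for all $t\in I$, then $m$ is a critical curve of $(\pi:M\to N,L,F)$. -/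

import Mathlib

open Set MeasureTheory
open scoped Manifold ContDiff Bundle

noncomputable section

section Forms

/-! ### Differential forms on a manifold -/

variable {E : Type*} [NormedAddCommGroup E] [NormedSpace ℝ E]
  {H : Type*} [TopologicalSpace H] (I : ModelWithCorners ℝ E H)
  {M : Type*} [TopologicalSpace M] [ChartedSpace H M]
  {E' : Type*} [NormedAddCommGroup E'] [NormedSpace ℝ E']
  {H' : Type*} [TopologicalSpace H'] (I' : ModelWithCorners ℝ E' H')
  {M' : Type*} [TopologicalSpace M'] [ChartedSpace H' M'] {k : ℕ}

variable (M k) in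
/-- A (not necessarily smooth) real `k`-form on the manifold `M`. -/
abbrev DiffForm : Type _ := (x : M) → (TangentSpace I x) [⋀^Fin k]→L[ℝ] ℝ

/-- The pull-back `f^* η` of a form along a map of manifolds. -/
def DiffForm.pullback (f : M → M') (η : DiffForm I' M' k) : DiffForm I M k := fun x =>
  (η (f x)).compContinuousLinearMap (mfderiv I I' f x)

/-- The expression of a form in the preferred chart at `x₀`, as a form on the model vector space
(meaningful on the target of that chart). -/
def DiffForm.inChart (η : DiffForm I M k) (x₀ : M) : E → E [⋀^Fin k]→L[ℝ] ℝ := fun z =>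
  (η ((extChartAt I x₀).symm z)).compContinuousLinearMap
    (mfderivWithin 𝓘(ℝ, E) I (extChartAt I x₀).symm (range I) z)

/-- A form is smooth if its expressions in charts are. -/
def DiffForm.IsSmooth (η : DiffForm I M k) : Prop :=
  ∀ x₀ : M, ContDiffOn ℝ ∞ (DiffForm.inChart I η x₀) (extChartAt I x₀).target

/-- The exterior derivative, computed at `x` in the preferred chart at `x`. -/
def DiffForm.d (η : DiffForm I M k) : DiffForm I M (k + 1) := fun x =>
  (extDerivWithin (DiffForm.inChart I η x) (range I)
    (extChartAt I x x)).compContinuousLinearMap (mfderiv I 𝓘(ℝ, E) (extChartAt I x) x)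

variable (M) in
/-- The cotangent bundle `T^*M`. -/
abbrev CotangentBundle : Type _ :=
  Bundle.TotalSpace (E →L[ℝ] ℝ) (fun x : M => TangentSpace I x →L[ℝ] ℝ)

variable [IsManifold I ∞ M]

variable (M) in
/-- The Liouville form `θ` on `T^*M`: `θ_α (V) = ⟨α, T τ (V)⟩`, with `τ : T^*M → M`. -/
def liouvilleForm : DiffForm (I.prod 𝓘(ℝ, E →L[ℝ] ℝ)) (CotangentBundle I M) 1 := fun α =>
  ContinuousAlternatingMap.ofSubsingleton ℝ _ ℝ (0 : Fin 1)
    (α.2.comp (mfderiv (I.prod 𝓘(ℝ, E →L[ℝ] ℝ)) I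
      (fun α' : CotangentBundle I M => α'.proj) α))

variable (M) in
/-- The symplectic form `ω = dθ` of `T^*M`. -/
def canonicalSymplecticForm : DiffForm (I.prod 𝓘(ℝ, E →L[ℝ] ℝ)) (CotangentBundle I M) 2 :=
  DiffForm.d _ (liouvilleForm I M)

end Forms

section Lagrangian

/-! ### Lagrangian systems and critical curves -/

variable {E : Type*} [NormedAddCommGroup E] [NormedSpace ℝ E]
  {H : Type*} [TopologicalSpace H] (I : ModelWithCorners ℝ E H)
  {M : Type*} [TopologicalSpace M] [ChartedSpace H M]

/-- The velocity at time `t` of a curve defined on `[a, b]` (one-sided at the end points). -/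
def velocity (a b : ℝ) (m : ℝ → M) (t : ℝ) : TangentSpace I (m t) :=
  mfderivWithin 𝓘(ℝ, ℝ) I m (Icc a b) t (1 : ℝ)

/-- The curve `ṁ` in `TM`. -/
def tangentLift (a b : ℝ) (m : ℝ → M) (t : ℝ) : TangentBundle I M :=
  ⟨m t, velocity I a b m t⟩

variable (M) in
/-- A force term `F : TM → T^*M`, fibred over the identity of `M`. -/
abbrev ForceTerm : Type _ := (x : M) → TangentSpace I x → (TangentSpace I x →L[ℝ] ℝ)

/-- The gyroscopic force term `F(v) = - i_v β` of a 2-form `β`. -/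
def gyroscopicForce (β : DiffForm I M 2) : ForceTerm I M := fun x v =>
  - (β x).toContinuousLinearMap ![v, 0] 1

theorem gyroscopicForce_apply (β : DiffForm I M 2) (x : M) (v w : TangentSpace I x) :
    gyroscopicForce I β x v w = - β x ![v, w] := by
  have h : Function.update ![v, 0] 1 w = ![v, w] := by
    ext i; fin_cases i <;> simp
  simp [gyroscopicForce, ContinuousAlternatingMap.toContinuousLinearMap, h]

/-- The action `∫_a^b L(ṁ(t)) dt`. -/
def action (L : TangentBundle I M → ℝ) (a b : ℝ) (m : ℝ → M) : ℝ :=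
  ∫ t in a..b, L (tangentLift I a b m t)

/-- `h (ε, t)`, `|ε| < r`, `t ∈ [a, b]`, is a smooth deformation of the curve `m` on `[a, b]` with
fixed end points. -/
structure IsDeformation (a b : ℝ) (m : ℝ → M) (r : ℝ) (h : ℝ × ℝ → M) : Prop where
  pos : 0 < r
  smooth : ContMDiffOn 𝓘(ℝ, ℝ × ℝ) I ∞ h (Ioo (-r) r ×ˢ Icc a b)
  zero : ∀ t ∈ Icc a b, h (0, t) = m t
  left : ∀ ε ∈ Ioo (-r) r, h (ε, a) = m a
  right : ∀ ε ∈ Ioo (-r) r, h (ε, b) = m b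

/-- The variation `δm(t) = d/dε|_{ε = 0} h (ε, t)` of a deformation. -/
def variation (h : ℝ × ℝ → M) (t : ℝ) : TangentSpace I (h (0, t)) :=
  mfderiv 𝓘(ℝ, ℝ) I (fun ε : ℝ => h (ε, t)) 0 (1 : ℝ)

/-- The smooth curve `m : [a, b] → M` is critical for the Lagrangian system `(M, L, F)`: for each
smooth deformation with fixed end points,
`δ ∫ L(ṁ) dt` exists and `δ ∫ L(ṁ) dt + ∫ ⟨F(ṁ), δm⟩ dt = 0`. -/
def IsCriticalCurve (L : TangentBundle I M → ℝ) (F : ForceTerm I M) (a b : ℝ) (m : ℝ → M) :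
    Prop :=
  ContMDiffOn 𝓘(ℝ, ℝ) I ∞ m (Icc a b) ∧
  ∀ (r : ℝ) (h : ℝ × ℝ → M), IsDeformation I a b m r h →
    DifferentiableAt ℝ (fun ε => action I L a b (fun t => h (ε, t))) 0 ∧
    deriv (fun ε => action I L a b (fun t => h (ε, t))) 0 +
      ∫ t in a..b, F (h (0, t)) (velocity I a b (fun s => h (0, s)) t) (variation I h t) = 0

end Lagrangian

section Constrained

/-! ### Intrinsically constrained Lagrangian systems -/

variable {EM : Type*} [NormedAddCommGroup EM] [NormedSpace ℝ EM]
  {HM : Type*} [TopologicalSpace HM] (IM : ModelWithCorners ℝ EM HM)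
  {M : Type*} [TopologicalSpace M] [ChartedSpace HM M]
  {EN : Type*} [NormedAddCommGroup EN] [NormedSpace ℝ EN]
  {HN : Type*} [TopologicalSpace HN] (IN : ModelWithCorners ℝ EN HN)
  {N : Type*} [TopologicalSpace N] [ChartedSpace HN N] [IsManifold IN ∞ N]
  (p : C^∞⟮IM, M; IN, N⟯)

/-- `p : M → N` is a fibred manifold: a surjective submersion. -/
structure IsFibredManifold : Prop where
  surjective : Function.Surjective p
  submersive : ∀ x : M, Function.Surjective (mfderiv IM IN p x)

/-- The fibred product `T_M N = TN ×_N M`, realised as the pull-back bundle `p^* TN` over `M`: the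
element `(v_n, m)`, with `v_n ∈ T_n N` and `n = p m`, is written `⟨m, v_n⟩`. -/
abbrev TMN : Type _ := Bundle.TotalSpace EN (p *ᵖ (TangentSpace IN : N → Type _))

/-- The fibred product `T_M^* N = T^*N ×_N M`. -/
abbrev CoTMN : Type _ :=
  Bundle.TotalSpace (EN →L[ℝ] ℝ) (p *ᵖ (fun x : N => TangentSpace IN x →L[ℝ] ℝ))

/-- The map `p₁ = (T p, τ_M) : TM → T_M N`. -/
def toTMN (v : TangentBundle IM M) : TMN IM IN p := ⟨v.proj, mfderiv IM IN p v.proj v.2⟩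

/-- The curve `m : [a, b] → M` is critical for the intrinsically constrained Lagrangian system
`(p : M → N, L, F)`. -/
def IsConstrainedCriticalCurve (L : TMN IM IN p → ℝ) (F : ForceTerm IM M) (a b : ℝ)
    (m : ℝ → M) : Prop :=
  IsCriticalCurve IM (L ∘ toTMN IM IN p) F a b m

/-- The Legendre map `𝔽₁ L : T_M N → T_M^* N`, the derivative of `L` along the fibres of
`T_M N → M`. -/
def legendreMap (L : TMN IM IN p → ℝ) (z : TMN IM IN p) : CoTMN IM IN p :=
  ⟨z.proj, fderiv ℝ (fun v : TangentSpace IN (p z.proj) => L ⟨z.proj, v⟩) z.2⟩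

/-- The projection `T_M^* N → T^*N`. -/
def coProj (α : CoTMN IM IN p) : CotangentBundle IN N := ⟨p α.proj, α.2⟩

/-- The energy `E_L (v_n, m) = ⟨𝔽₁ L (v_n, m), (v_n, m)⟩ - L (v_n, m)`. -/
def energy (L : TMN IM IN p → ℝ) (z : TMN IM IN p) : ℝ :=
  (coProj IM IN p (legendreMap IM IN p L z)).2 z.2 - L z

/-- The 2-form `(π̄₁ ∘ 𝔽₁ L)^* ω_N + π₂^* β` on `T_M N`. -/
def presymplecticForm (L : TMN IM IN p → ℝ) (β : DiffForm IM M 2) :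
    DiffForm (IM.prod 𝓘(ℝ, EN)) (TMN IM IN p) 2 :=
  DiffForm.pullback (IM.prod 𝓘(ℝ, EN)) (IN.prod 𝓘(ℝ, EN →L[ℝ] ℝ))
      (coProj IM IN p ∘ legendreMap IM IN p L) (canonicalSymplecticForm IN N)
    + DiffForm.pullback (IM.prod 𝓘(ℝ, EN)) IM (fun z : TMN IM IN p => z.proj) β

/-- The curve `γ = (ṅ, m)` in `T_M N`, with `n = p ∘ m`. -/
def constrainedLift (a b : ℝ) (m : ℝ → M) (t : ℝ) : TMN IM IN p :=
  ⟨m t, velocity IN a b (fun s => p (m s)) t⟩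

/-- The smooth curve `γ : [a, b] → T_M N` solves
`i_{γ̇(t)} ((π̄₁ ∘ 𝔽₁ L)^* ω_N + π₂^* β) = - d E_L` along `γ`. -/
def SolvesPresymplecticEquation (L : TMN IM IN p → ℝ) (β : DiffForm IM M 2) (a b : ℝ)
    (γ : ℝ → TMN IM IN p) : Prop :=
  ContMDiffOn 𝓘(ℝ, ℝ) (IM.prod 𝓘(ℝ, EN)) ∞ γ (Icc a b) ∧
  ∀ t ∈ Icc a b, ∀ V : TangentSpace (IM.prod 𝓘(ℝ, EN)) (γ t),
    presymplecticForm IM IN p L β (γ t) ![velocity (IM.prod 𝓘(ℝ, EN)) a b γ t, V]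
      = - mfderiv (IM.prod 𝓘(ℝ, EN)) 𝓘(ℝ, ℝ) (energy IM IN p L) (γ t) V

end Constrained

end

/-!
In coordinates `y` on `M`, `n` on `N` and `v = ṅ` on the fibres of `T_M N`, write `P = ∂L/∂v` for
the Legendre map. Then `(π̄₁ ∘ 𝔽₁ L)^* ω_N = dP ∧ dn` (`canonicalSymplecticForm_apply`,
`presymplecticForm_apply`) and `d E_L = (dP) v - ∂L/∂y dy` (`mfderiv_energy_apply`). For a smooth
family of curves `m_ε` with lifts `γ_ε = (ṅ_ε, m_ε)` and variation `δm`, symmetry of second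
derivatives gives
`d/dε L (γ_ε) = ∂L/∂y δm + P (d/dt δn) = d/dt (P δn) + ∂L/∂y δm - (dP/dt) δn`.
Along `γ` one has `T p (γ̇) = ṅ = v`, so the two contributions `dP (W) v`, with `W` tangent to
`T_M N` over `δm`, cancel between the 2-form and the energy, and the right-hand side together with
the work `-β (ṁ, δm)` of the force is `d/dt (P δn)` minus the value at `W` of
`i_γ̇ ((π̄₁ ∘ 𝔽₁ L)^* ω_N + π₂^* β) + d E_L`. This pointwise identity is `first_variation_formula`;
it holds for every lift `W` of `δm`, so it also shows that this 1-form along `γ` vanishes on vectors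
which are vertical over `M`.

Integrating over `[a, b]` (`first_variation_of_action`) and using that `δn` vanishes at the end
points gives the converse part at once. For the direct part, take any family through `m`, without
end point conditions, and rescale it to `h (ε ξ(t), t)` with a bump function `ξ` supported in
`(a, b)`. This is a deformation with fixed end points and variation `ξ δm`, so criticality and the
fundamental lemma of the calculus of variations show that the 1-form vanishes on `δm` at each
`t ∈ [a, b]` (`variationDefect_eq_zero`). As `δm (t₀)` can be prescribed at any one time `t₀`
(`exists_family_with_variation`), the 1-form is zero.

The pointwise identity at time `t` is computed in the preferred chart at `γ (t)`, the chart in which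
`DiffForm.d` is evaluated there; hence the argument needs no invariance of the exterior derivative
under changes of charts.
-/

noncomputable section

open Filter Topology Bundle

/-! ### Derivatives of maps into manifolds and bundles, in charts -/

section Charts

variable {E : Type*} [NormedAddCommGroup E] [NormedSpace ℝ E]
  {H : Type*} [TopologicalSpace H] {I : ModelWithCorners ℝ E H}
  {M : Type*} [TopologicalSpace M] [ChartedSpace H M]
  {E' : Type*} [NormedAddCommGroup E'] [NormedSpace ℝ E']
  {H' : Type*} [TopologicalSpace H'] {I' : ModelWithCorners ℝ E' H'}
  {M' : Type*} [TopologicalSpace M'] [ChartedSpace H' M']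
  {X : Type*} [NormedAddCommGroup X] [NormedSpace ℝ X]

/-- Into a manifold, the derivative is by definition the derivative in the preferred chart at the
image point. -/
theorem mfderivWithin_eq_fderivWithin_extChartAt_comp {f : X → M} {s : Set X} {x : X}
    (hf : MDifferentiableWithinAt 𝓘(ℝ, X) I f s x) (v : X) :
    (mfderivWithin 𝓘(ℝ, X) I f s x v : E) = fderivWithin ℝ (extChartAt I (f x) ∘ f) s x v := by
  rw [hf.mfderivWithin]
  simp [writtenInExtChartAt]
  rfl

theorem trivializationAt_tangent_eq_continuousLinearMapAt [IsManifold I 1 M] {x₀ x : M}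
    (hx : x ∈ (chartAt H x₀).source) (v : TangentSpace I x) :
    (trivializationAt E (TangentSpace I) x₀ ⟨x, v⟩).2 =
      (trivializationAt E (TangentSpace I : M → Type _) x₀).continuousLinearMapAt ℝ x v := by
  rw [Trivialization.continuousLinearMapAt_apply,
    Trivialization.coe_linearMapAt_of_mem _ (by simpa using hx)]

/-- In the coordinates of an arbitrary chart around the image point, the derivative of `f` is the
derivative of the coordinate expression of `f`. -/
theorem trivializationAt_mfderivWithin [IsManifold I 1 M] {f : X → M} {s : Set X} {x : X} {x₀ : M}
    (hf : MDifferentiableWithinAt 𝓘(ℝ, X) I f s x) (hs : UniqueDiffWithinAt ℝ s x)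
    (hx : f x ∈ (chartAt H x₀).source) (v : X) :
    (trivializationAt E (TangentSpace I) x₀ ⟨f x, mfderivWithin 𝓘(ℝ, X) I f s x v⟩).2 =
      fderivWithin ℝ (extChartAt I x₀ ∘ f) s x v := by
  rw [trivializationAt_tangent_eq_continuousLinearMapAt hx,
    TangentBundle.continuousLinearMapAt_trivializationAt hx, ← mfderivWithin_eq_fderivWithin,
    mfderiv_comp_mfderivWithin x (mdifferentiableAt_extChartAt hx) hf hs.uniqueMDiffWithinAt]
  rfl

theorem trivializationAt_tangent_self [IsManifold I 1 M] (x : M) (v : TangentSpace I x) :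
    (trivializationAt E (TangentSpace I) x ⟨x, v⟩).2 = v := by
  exact (tangentBundleCore I M).coordChange_self (achart H x) x (mem_chart_source H x) v

/-- The coordinate map of a tangent space, with its domain regarded as the model space `E`. -/
theorem exists_trivializationAt_tangent_eq [IsManifold I 1 M] {x₀ x : M}
    (hx : x ∈ (chartAt H x₀).source) : ∃ A : E →L[ℝ] E, Function.Surjective A ∧
      ∀ v : E, (trivializationAt E (TangentSpace I) x₀ (⟨x, v⟩ : TangentBundle I M)).2 = A v := by
  have hb : x ∈ (trivializationAt E (TangentSpace I : M → Type _) x₀).baseSet := by simpa using hx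
  have h := trivializationAt_tangent_eq_continuousLinearMapAt (I := I) hx
  refine ⟨(trivializationAt E (TangentSpace I : M → Type _) x₀).continuousLinearMapAt ℝ x,
    fun u => ⟨(trivializationAt E (TangentSpace I : M → Type _) x₀).symm x u, ?_⟩, h⟩
  refine (h _).symm.trans ?_
  rw [Trivialization.apply_mk_symm _ hb]

variable {F : Type*} [NormedAddCommGroup F] [NormedSpace ℝ F] {V : M' → Type*}
  [TopologicalSpace (TotalSpace F V)] [∀ x, TopologicalSpace (V x)]
  [FiberBundle F V]

theorem mem_extChartAt_totalSpace_source {x₀ z : TotalSpace F V} :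
    z ∈ (extChartAt (I'.prod 𝓘(ℝ, F)) x₀).source ↔
      z.proj ∈ (trivializationAt F V x₀.proj).baseSet ∧ z.proj ∈ (chartAt H' x₀.proj).source := by
  rw [FiberBundle.extChartAt]
  simp only [PartialEquiv.trans_source, mem_inter_iff, mem_preimage, PartialEquiv.prod_source,
    PartialEquiv.refl_source, mem_prod, mem_univ, and_true, extChartAt_source]
  refine ⟨fun ⟨h1, h2⟩ => ?_, fun ⟨h1, h2⟩ => ?_⟩
  · have h := Trivialization.coe_fst _ h1
    have h2' : (trivializationAt F V x₀.proj z).1 ∈ (chartAt H' x₀.proj).source := h2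
    rw [h] at h2'
    exact ⟨(Trivialization.mem_source _).1 h1, h2'⟩
  · have h1' := (Trivialization.mem_source _).2 h1
    have h := Trivialization.coe_fst _ h1'
    refine ⟨h1', ?_⟩
    change (trivializationAt F V x₀.proj z).1 ∈ (chartAt H' x₀.proj).source
    rwa [h]

theorem extChartAt_totalSpace_apply {x₀ z : TotalSpace F V}
    (hz : z.proj ∈ (trivializationAt F V x₀.proj).baseSet) :
    extChartAt (I'.prod 𝓘(ℝ, F)) x₀ z =
      (extChartAt I' x₀.proj z.proj, (trivializationAt F V x₀.proj z).2) := by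
  have h := Trivialization.coe_fst _ ((Trivialization.mem_source _).2 hz)
  rw [FiberBundle.extChartAt]
  exact Prod.ext (congrArg (extChartAt I' x₀.proj) h) rfl

/-- Under the identification of the tangent spaces of a total space with `E' × F`, the derivative of
a map `f` consists of the derivatives of its base component and of its fibre component, the latter
read in the trivialization at the point itself. -/
theorem mfderivWithin_totalSpace
    {f : M → TotalSpace F V} {s : Set M} {x : M}
    (hf : MDifferentiableWithinAt I (I'.prod 𝓘(ℝ, F)) f s x) (hs : UniqueMDiffWithinAt I s x)
    (v : TangentSpace I x) :
    (mfderivWithin I (I'.prod 𝓘(ℝ, F)) f s x v : E' × F) =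
      ((mfderivWithin I I' (fun y => (f y).proj) s x v : E'),
       (mfderivWithin I 𝓘(ℝ, F)
         (fun y => (trivializationAt F V (f x).proj (f y)).2) s x v : F)) := by
  obtain ⟨h1, h2⟩ := (mdifferentiableWithinAt_totalSpace _ f).1 hf
  have key : mfderivWithin I (I'.prod 𝓘(ℝ, F))
      (fun y => (((f y).proj, (trivializationAt F V (f x).proj (f y)).2) : M' × F)) s x v =
      mfderivWithin I (I'.prod 𝓘(ℝ, F)) f s x v := by
    rw [hf.mfderivWithin, (h1.prodMk h2).mfderivWithin]
    refine congrArg (fun A : E →L[ℝ] E' × F => A v) (Filter.EventuallyEq.fderivWithin_eq ?_ ?_)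
    · have hc : ContinuousWithinAt f s x := hf.continuousWithinAt
      have hm : f ⁻¹' (trivializationAt F V (f x).proj).source ∈ 𝓝[s] x :=
        hc ((trivializationAt F V (f x).proj).open_source.mem_nhds
          FiberBundle.mem_trivializationAt_proj_source)
      have := (extChartAt_preimage_mem_nhdsWithin (I := I) hm)
      filter_upwards [this] with z hz
      simp only [writtenInExtChartAt, FiberBundle.extChartAt]
      have e : (trivializationAt F V (f x).proj (f ((extChartAt I x).symm z))).1 =
          (f ((extChartAt I x).symm z)).proj := Trivialization.coe_fst _ hz
      refine Prod.ext ?_ rfl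
      exact congrArg (extChartAt I' (f x).proj) e.symm
    · simp only [writtenInExtChartAt, FiberBundle.extChartAt]
      simp
      rfl
  rw [← key, mfderivWithin_prodMk h1 h2 hs]
  rfl

end Charts

/-! ### The Liouville form and the symplectic form of the cotangent bundle -/

section Liouville

variable {E : Type*} [NormedAddCommGroup E] [NormedSpace ℝ E]
  {H : Type*} [TopologicalSpace H] {I : ModelWithCorners ℝ E H}
  {M : Type*} [TopologicalSpace M] [ChartedSpace H M] [IsManifold I ∞ M]

/-- The pairing of covectors and vectors is preserved by the coordinates. -/
theorem CotangentBundle.trivializationAt_apply_tangent {x₀ : M} (α : CotangentBundle I M)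
    (hx : α.proj ∈ (chartAt H x₀).source) (w : TangentSpace I α.proj) :
    (trivializationAt (E →L[ℝ] ℝ) (fun x : M => TangentSpace I x →L[ℝ] ℝ) x₀ α).2
      (trivializationAt E (TangentSpace I) x₀ ⟨α.proj, w⟩).2 = α.2 w := by
  have hb : α.proj ∈ (trivializationAt E (TangentSpace I : M → Type _) x₀).baseSet := by
    simpa using hx
  rw [hom_trivializationAt_apply]
  simp only [ContinuousLinearMap.inCoordinates]
  rw [trivializationAt_tangent_eq_continuousLinearMapAt hx]
  have h2 := (trivializationAt E (TangentSpace I : M → Type _) x₀).symmL_continuousLinearMapAt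
    (R := ℝ) hb w
  simp only [ContinuousLinearMap.comp_apply, h2]
  simp

/-- In a chart, the Liouville form is the tautological form `(x, ξ) ↦ ξ dx`. -/
theorem liouvilleForm_inChart [I.Boundaryless] (α : CotangentBundle I M) :
    DiffForm.inChart _ (liouvilleForm I M) α =ᶠ[𝓝 (extChartAt (I.prod 𝓘(ℝ, E →L[ℝ] ℝ)) α α)]
      fun z => ContinuousAlternatingMap.ofSubsingleton ℝ (E × (E →L[ℝ] ℝ)) ℝ (0 : Fin 1)
        (z.2.comp (ContinuousLinearMap.fst ℝ E (E →L[ℝ] ℝ))) := by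
  filter_upwards [extChartAt_target_mem_nhds α] with z hz
  set c := extChartAt (I.prod 𝓘(ℝ, E →L[ℝ] ℝ)) α with hc
  ext v
  have hcs : MDifferentiableWithinAt 𝓘(ℝ, E × (E →L[ℝ] ℝ)) (I.prod 𝓘(ℝ, E →L[ℝ] ℝ)) c.symm
      (range (I.prod 𝓘(ℝ, E →L[ℝ] ℝ))) z := mdifferentiableWithinAt_extChartAt_symm hz
  have hzt : c (c.symm z) = z := c.right_inv hz
  have hsrc : c.symm z ∈ c.source := c.map_target hz
  have happ : ∀ y ∈ c.target, (c.symm y).proj ∈ (chartAt H α.proj).source ∧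
      extChartAt I α.proj (c.symm y).proj = y.1 ∧
      (trivializationAt (E →L[ℝ] ℝ) (fun x : M => TangentSpace I x →L[ℝ] ℝ) α.proj
        (c.symm y)).2 = y.2 := by
    intro y hy
    have h1 := mem_extChartAt_totalSpace_source.1 (c.map_target hy)
    have h2 := c.right_inv hy
    rw [hc, extChartAt_totalSpace_apply h1.1] at h2
    exact ⟨h1.2, congrArg Prod.fst h2, congrArg Prod.snd h2⟩
  obtain ⟨hbase, -, htriv⟩ := happ z hz
  have hu : UniqueMDiffWithinAt 𝓘(ℝ, E × (E →L[ℝ] ℝ)) (range (I.prod 𝓘(ℝ, E →L[ℝ] ℝ))) z := by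
    rw [ModelWithCorners.range_eq_univ]
    exact uniqueMDiffWithinAt_univ _
  have hp : MDifferentiableAt (I.prod 𝓘(ℝ, E →L[ℝ] ℝ)) I (fun α' : CotangentBundle I M => α'.proj)
    (c.symm z) := mdifferentiableAt_proj _
  -- in the charts, the bundle projection is the projection to the first factor
  have hcomp := mfderiv_comp_mfderivWithin z hp hcs hu
  have hfd : fderivWithin ℝ
      (extChartAt I α.proj ∘ (fun α' : CotangentBundle I M => α'.proj) ∘ c.symm)
      (range (I.prod 𝓘(ℝ, E →L[ℝ] ℝ))) z = ContinuousLinearMap.fst ℝ E (E →L[ℝ] ℝ) := by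
    rw [ModelWithCorners.range_eq_univ, fderivWithin_univ,
      Filter.EventuallyEq.fderiv_eq (f := Prod.fst), fderiv_fst]
    filter_upwards [extChartAt_target_mem_nhds' hz] with y hy using (happ y hy).2.1
  have hl := trivializationAt_mfderivWithin (x₀ := α.proj) (hp.comp_mdifferentiableWithinAt z hcs)
    hu.uniqueDiffWithinAt hbase (v 0)
  rw [hfd, hcomp] at hl
  have hα := CotangentBundle.trivializationAt_apply_tangent (c.symm z) hbase
    (mfderiv (I.prod 𝓘(ℝ, E →L[ℝ] ℝ)) I (fun α' : CotangentBundle I M => α'.proj) (c.symm z)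
      (mfderivWithin 𝓘(ℝ, E × (E →L[ℝ] ℝ)) (I.prod 𝓘(ℝ, E →L[ℝ] ℝ)) c.symm
        (range (I.prod 𝓘(ℝ, E →L[ℝ] ℝ))) z (v 0)))
  rw [htriv] at hα
  exact hα.symm.trans (congrArg z.2 hl)

theorem differentiable_ofSubsingleton {X : Type*} [NormedAddCommGroup X] [NormedSpace ℝ X]
    {f : X → X →L[ℝ] ℝ} (hf : Differentiable ℝ f) :
    Differentiable ℝ fun z => ContinuousAlternatingMap.ofSubsingleton ℝ X ℝ (0 : Fin 1) (f z) :=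
  (ContinuousAlternatingMap.ofSubsingletonLIE (𝕜 := ℝ) (E := X) (F := ℝ)
    (0 : Fin 1)).differentiable.comp hf

theorem extDeriv_tautologicalForm (z U W : E × (E →L[ℝ] ℝ)) :
    extDeriv (fun z : E × (E →L[ℝ] ℝ) =>
      ContinuousAlternatingMap.ofSubsingleton ℝ (E × (E →L[ℝ] ℝ)) ℝ (0 : Fin 1)
        (z.2.comp (ContinuousLinearMap.fst ℝ E (E →L[ℝ] ℝ)))) z ![U, W] = U.2 W.1 - W.2 U.1 := by
  have hd : Differentiable ℝ (fun z : E × (E →L[ℝ] ℝ) =>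
      ContinuousAlternatingMap.ofSubsingleton ℝ (E × (E →L[ℝ] ℝ)) ℝ (0 : Fin 1)
        (z.2.comp (ContinuousLinearMap.fst ℝ E (E →L[ℝ] ℝ)))) :=
    differentiable_ofSubsingleton (by fun_prop)
  have he : ∀ w : E, HasFDerivAt (fun x : E × (E →L[ℝ] ℝ) => x.2 w)
      ((ContinuousLinearMap.apply ℝ ℝ w).comp (ContinuousLinearMap.snd ℝ E (E →L[ℝ] ℝ))) z :=
    fun w => ((ContinuousLinearMap.apply ℝ ℝ w).comp
      (ContinuousLinearMap.snd ℝ E (E →L[ℝ] ℝ))).hasFDerivAt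
  have h1 : Fin.removeNth 1 ![U, W] 0 = U := rfl
  rw [extDeriv_apply (hd _)]
  simp [Fin.sum_univ_succ, h1, (he _).fderiv, sub_eq_add_neg]

/-- `ω = dξ ∧ dx` at each point, in the preferred chart there. -/
theorem canonicalSymplecticForm_apply [I.Boundaryless] (α : CotangentBundle I M)
    (U W : E × (E →L[ℝ] ℝ)) :
    canonicalSymplecticForm I M α ![U, W] = U.2 W.1 - W.2 U.1 := by
  simp only [canonicalSymplecticForm, DiffForm.d, mfderiv_extChartAt_self]
  rw [ModelWithCorners.range_eq_univ, extDerivWithin_univ, (liouvilleForm_inChart α).extDeriv_eq]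
  exact extDeriv_tautologicalForm _ U W

end Liouville

/-! ### The Lagrangian, the Legendre map and the energy in a chart -/

section LocalLagrangian

variable {EM : Type*} [NormedAddCommGroup EM] [NormedSpace ℝ EM]
  {HM : Type*} [TopologicalSpace HM] {IM : ModelWithCorners ℝ EM HM}
  {M : Type*} [TopologicalSpace M] [ChartedSpace HM M]
  {EN : Type*} [NormedAddCommGroup EN] [NormedSpace ℝ EN]
  {HN : Type*} [TopologicalSpace HN] {IN : ModelWithCorners ℝ EN HN}
  {N : Type*} [TopologicalSpace N] [ChartedSpace HN N] [IsManifold IN ∞ N]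
  {p : C^∞⟮IM, M; IN, N⟯}

theorem TMN.mem_extChartAt_source {z₀ z : TMN IM IN p} :
    z ∈ (extChartAt (IM.prod 𝓘(ℝ, EN)) z₀).source ↔
      p z.proj ∈ (chartAt HN (p z₀.proj)).source ∧ z.proj ∈ (chartAt HM z₀.proj).source :=
  mem_extChartAt_totalSpace_source

theorem TMN.extChartAt_apply {z₀ z : TMN IM IN p}
    (hz : p z.proj ∈ (chartAt HN (p z₀.proj)).source) :
    extChartAt (IM.prod 𝓘(ℝ, EN)) z₀ z = (extChartAt IM z₀.proj z.proj,
      (trivializationAt EN (TangentSpace IN) (p z₀.proj) ⟨p z.proj, z.2⟩).2) :=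
  extChartAt_totalSpace_apply hz

/-- The Lagrangian in the preferred chart of `T_M N` at `z₀`, as a function of the coordinates
`(y, v)`. -/
def lagrangianInChart (L : TMN IM IN p → ℝ) (z₀ : TMN IM IN p) (u : EM × EN) : ℝ :=
  L ((extChartAt (IM.prod 𝓘(ℝ, EN)) z₀).symm u)

/-- The momentum `∂L/∂v` in the preferred chart of `T_M N` at `z₀`. -/
def momentumInChart (L : TMN IM IN p → ℝ) (z₀ : TMN IM IN p) (u : EM × EN) : EN →L[ℝ] ℝ :=
  (fderiv ℝ (lagrangianInChart L z₀) u).comp (ContinuousLinearMap.inr ℝ EM EN)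

variable {L : TMN IM IN p → ℝ} {z₀ z : TMN IM IN p}

theorem lagrangianInChart_extChartAt
    (hz : z ∈ (extChartAt (IM.prod 𝓘(ℝ, EN)) z₀).source) :
    lagrangianInChart L z₀ (extChartAt (IM.prod 𝓘(ℝ, EN)) z₀ z) = L z := by
  rw [lagrangianInChart, (extChartAt _ z₀).left_inv hz]

theorem contDiffAt_lagrangianInChart [IsManifold IM ∞ M] [IM.Boundaryless]
    (hL : ContMDiff (IM.prod 𝓘(ℝ, EN)) 𝓘(ℝ, ℝ) ∞ L)
    {u : EM × EN} (hu : u ∈ (extChartAt (IM.prod 𝓘(ℝ, EN)) z₀).target) :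
    ContDiffAt ℝ ∞ (lagrangianInChart L z₀) u := by
  rw [← contMDiffAt_iff_contDiffAt]
  exact hL.contMDiffAt.comp u ((contMDiffOn_extChartAt_symm z₀ u hu).contMDiffAt
    (extChartAt_target_mem_nhds' hu))

theorem contDiffAt_momentumInChart [IsManifold IM ∞ M] [IM.Boundaryless]
    (hL : ContMDiff (IM.prod 𝓘(ℝ, EN)) 𝓘(ℝ, ℝ) ∞ L)
    {u : EM × EN} (hu : u ∈ (extChartAt (IM.prod 𝓘(ℝ, EN)) z₀).target) :
    ContDiffAt ℝ ∞ (momentumInChart L z₀) u :=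
  ((contDiffAt_lagrangianInChart hL hu).fderiv_right (m := ∞) (by simp)).clm_comp contDiffAt_const

variable [IsManifold IM ∞ M] [IM.Boundaryless] (hL : ContMDiff (IM.prod 𝓘(ℝ, EN)) 𝓘(ℝ, ℝ) ∞ L)
  (hz : z ∈ (extChartAt (IM.prod 𝓘(ℝ, EN)) z₀).source)

include hL hz

/-- The Legendre map is the partial derivative `∂L/∂v`, in any chart around `z`. -/
theorem legendreMap_apply_eq_momentumInChart (w : TangentSpace IN (p z.proj)) :
    (coProj IM IN p (legendreMap IM IN p L z)).2 w =
      momentumInChart L z₀ (extChartAt (IM.prod 𝓘(ℝ, EN)) z₀ z)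
        (trivializationAt EN (TangentSpace IN) (p z₀.proj) ⟨p z.proj, w⟩).2 := by
  obtain ⟨h1, h2⟩ := TMN.mem_extChartAt_source.1 hz
  obtain ⟨A, -, hA⟩ := exists_trivializationAt_tangent_eq (I := IN) h1
  have hc : ∀ v : EN, extChartAt (IM.prod 𝓘(ℝ, EN)) z₀ (⟨z.proj, v⟩ : TMN IM IN p) =
      (extChartAt IM z₀.proj z.proj, A v) := fun v =>
    (TMN.extChartAt_apply (z := (⟨z.proj, v⟩ : TMN IM IN p)) h1).trans
      (Prod.ext rfl (hA v))
  have hfun : ∀ v : EN, L (⟨z.proj, v⟩ : TMN IM IN p) =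
      lagrangianInChart L z₀ (extChartAt IM z₀.proj z.proj, A v) := fun v =>
    (lagrangianInChart_extChartAt (z := (⟨z.proj, v⟩ : TMN IM IN p))
      (TMN.mem_extChartAt_source.2 ⟨h1, h2⟩)).symm.trans (congrArg _ (hc v))
  obtain ⟨x, v⟩ := z
  have hu : extChartAt (IM.prod 𝓘(ℝ, EN)) z₀ (⟨x, v⟩ : TMN IM IN p) =
    (extChartAt IM z₀.proj x, A v) := hc v
  have hd : DifferentiableAt ℝ (lagrangianInChart L z₀) (extChartAt IM z₀.proj x, A v) := by
    rw [← hu]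
    exact (contDiffAt_lagrangianInChart hL ((extChartAt _ z₀).map_source hz)).differentiableAt
      (by simp)
  have hder : ∀ v : EN,
      DifferentiableAt ℝ (lagrangianInChart L z₀) (extChartAt IM z₀.proj x, A v) →
      HasFDerivAt (fun v : EN => L (⟨x, v⟩ : TMN IM IN p))
        ((fderiv ℝ (lagrangianInChart L z₀) (extChartAt IM z₀.proj x, A v)).comp
          ((0 : EN →L[ℝ] EM).prod A)) v := fun v hd => by
    have hg : HasFDerivAt (fun v : EN => (extChartAt IM z₀.proj x, A v))
        ((0 : EN →L[ℝ] EM).prod A) v := (hasFDerivAt_const _ _).prodMk A.hasFDerivAt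
    have hcomp := hd.hasFDerivAt.comp v hg
    exact hcomp.congr_of_eventuallyEq (Eventually.of_forall hfun)
  refine (congrArg (fun B : EN →L[ℝ] ℝ => B w) (hder v hd).fderiv).trans ?_
  rw [hu]
  exact congrArg (fun u => fderiv ℝ (lagrangianInChart L z₀) _ ((0 : EM), u)) (hA w).symm

theorem trivializationAt_coProj_legendreMap :
    (trivializationAt (EN →L[ℝ] ℝ) (fun x : N => TangentSpace IN x →L[ℝ] ℝ) (p z₀.proj)
      (coProj IM IN p (legendreMap IM IN p L z))).2 =
      momentumInChart L z₀ (extChartAt (IM.prod 𝓘(ℝ, EN)) z₀ z) := by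
  obtain ⟨h1, h2⟩ := TMN.mem_extChartAt_source.1 hz
  obtain ⟨A, hs, hA⟩ := exists_trivializationAt_tangent_eq (I := IN) h1
  -- both sides agree on coordinates of tangent vectors, and these exhaust the model space
  ext u
  obtain ⟨w, rfl⟩ := hs u
  have e1 := legendreMap_apply_eq_momentumInChart hL hz w
  have e2 := CotangentBundle.trivializationAt_apply_tangent
    (coProj IM IN p (legendreMap IM IN p L z)) h1 w
  refine (congrArg _ (hA w)).symm.trans (e2.trans (e1.trans (congrArg _ (hA w))))

theorem energy_eq_inChart :
    energy IM IN p L z =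
      momentumInChart L z₀ (extChartAt (IM.prod 𝓘(ℝ, EN)) z₀ z)
        (extChartAt (IM.prod 𝓘(ℝ, EN)) z₀ z).2
      - lagrangianInChart L z₀ (extChartAt (IM.prod 𝓘(ℝ, EN)) z₀ z) := by
  obtain ⟨h1, h2⟩ := TMN.mem_extChartAt_source.1 hz
  rw [energy, lagrangianInChart_extChartAt hz]
  refine congrArg (· - L z) ((legendreMap_apply_eq_momentumInChart hL hz z.2).trans ?_)
  exact congrArg _ (congrArg Prod.snd (TMN.extChartAt_apply h1)).symm

end LocalLagrangian

/-! ### The presymplectic form and the differential of the energy -/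

section PresymplecticLocal

variable {EM : Type*} [NormedAddCommGroup EM] [NormedSpace ℝ EM]
  {HM : Type*} [TopologicalSpace HM] {IM : ModelWithCorners ℝ EM HM}
  {M : Type*} [TopologicalSpace M] [ChartedSpace HM M]
  {EN : Type*} [NormedAddCommGroup EN] [NormedSpace ℝ EN]
  {HN : Type*} [TopologicalSpace HN] {IN : ModelWithCorners ℝ EN HN}
  {N : Type*} [TopologicalSpace N] [ChartedSpace HN N] [IsManifold IN ∞ N]
  {p : C^∞⟮IM, M; IN, N⟯} [IsManifold IM ∞ M]

omit [IsManifold IM ∞ M] in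
theorem mfderiv_totalSpace_proj {F : Type*} [NormedAddCommGroup F] [NormedSpace ℝ F] {V : M → Type*}
    [TopologicalSpace (TotalSpace F V)] [∀ x, TopologicalSpace (V x)] [FiberBundle F V]
    (z : TotalSpace F V) (W : TangentSpace (IM.prod 𝓘(ℝ, F)) z) :
    mfderiv (IM.prod 𝓘(ℝ, F)) IM (fun z : TotalSpace F V => z.proj) z W = (W : EM × F).1 := by
  have h := mfderivWithin_totalSpace (I := IM.prod 𝓘(ℝ, F)) (I' := IM) (f := id) (s := univ)
    (x := z) mdifferentiableWithinAt_id (uniqueMDiffWithinAt_univ _) W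
  rw [mfderivWithin_univ, mfderivWithin_univ, mfderiv_id] at h
  exact (congrArg Prod.fst h).symm

theorem hasMFDerivAt_of_comp_extChartAt {Y : Type*} [NormedAddCommGroup Y] [NormedSpace ℝ Y]
    {x : M} {f : M → Y} {g : EM → Y} {g' : EM →L[ℝ] Y} (hg : HasFDerivAt g g' (extChartAt IM x x))
    (hf : f =ᶠ[𝓝 x] g ∘ extChartAt IM x) : HasMFDerivAt IM 𝓘(ℝ, Y) f x g' := by
  have h1 := hg.hasMFDerivAt.comp x
    (mdifferentiableAt_extChartAt (I := IM) (mem_chart_source HM x)).hasMFDerivAt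
  rw [mfderiv_extChartAt_self] at h1
  exact h1.congr_of_eventuallyEq hf

variable {L : TMN IM IN p → ℝ} [IM.Boundaryless] [IN.Boundaryless]
  (hL : ContMDiff (IM.prod 𝓘(ℝ, EN)) 𝓘(ℝ, ℝ) ∞ L) (z₀ : TMN IM IN p)
include hL

/-- The coordinate expression `(π̄₁ ∘ 𝔽₁ L)^* ω_N + π₂^* β = dP ∧ dn + β`. -/
theorem presymplecticForm_apply (β : DiffForm IM M 2)  (U W : EM × EN) :
    presymplecticForm IM IN p L β z₀ ![U, W] =
      fderiv ℝ (momentumInChart L z₀) (extChartAt (IM.prod 𝓘(ℝ, EN)) z₀ z₀) U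
        (mfderiv IM IN p z₀.proj W.1) -
      fderiv ℝ (momentumInChart L z₀) (extChartAt (IM.prod 𝓘(ℝ, EN)) z₀ z₀) W
        (mfderiv IM IN p z₀.proj U.1) + β z₀.proj ![U.1, W.1] := by
  set f : TMN IM IN p → CotangentBundle IN N := coProj IM IN p ∘ legendreMap IM IN p L with hf
  have hP : HasMFDerivAt (IM.prod 𝓘(ℝ, EN)) 𝓘(ℝ, EN →L[ℝ] ℝ)
      (fun z => (trivializationAt (EN →L[ℝ] ℝ) (fun x : N => TangentSpace IN x →L[ℝ] ℝ)
        (f z₀).proj (f z)).2) z₀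
      (fderiv ℝ (momentumInChart L z₀) (extChartAt (IM.prod 𝓘(ℝ, EN)) z₀ z₀)) := by
    refine hasMFDerivAt_of_comp_extChartAt ((contDiffAt_momentumInChart hL
      (mem_extChartAt_target z₀)).differentiableAt (by simp)).hasFDerivAt ?_
    filter_upwards [extChartAt_source_mem_nhds (I := IM.prod 𝓘(ℝ, EN)) z₀] with z hz
    exact trivializationAt_coProj_legendreMap hL hz
  have hpm : MDifferentiableAt IM IN p z₀.proj := p.contMDiff.mdifferentiableAt (by simp)
  have hpr : MDifferentiableAt (IM.prod 𝓘(ℝ, EN)) IM (fun z : TMN IM IN p => z.proj) z₀ :=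
    mdifferentiableAt_proj _
  have hfd : MDifferentiableAt (IM.prod 𝓘(ℝ, EN)) (IN.prod 𝓘(ℝ, EN →L[ℝ] ℝ)) f z₀ :=
    (mdifferentiableAt_totalSpace _ f).2 ⟨hpm.comp z₀ hpr, hP.mdifferentiableAt⟩
  have hder : ∀ W : EM × EN, (mfderiv (IM.prod 𝓘(ℝ, EN)) (IN.prod 𝓘(ℝ, EN →L[ℝ] ℝ)) f z₀ W :
      EN × (EN →L[ℝ] ℝ)) = ((mfderiv IM IN p z₀.proj W.1 : EN),
        fderiv ℝ (momentumInChart L z₀) (extChartAt (IM.prod 𝓘(ℝ, EN)) z₀ z₀) W) := by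
    intro W
    have h := mfderivWithin_totalSpace (I' := IN) (s := univ)
      hfd.mdifferentiableWithinAt (uniqueMDiffWithinAt_univ _) W
    rw [mfderivWithin_univ, mfderivWithin_univ, mfderivWithin_univ, hP.mfderiv] at h
    have hc : mfderiv (IM.prod 𝓘(ℝ, EN)) IN (fun z => (f z).proj) z₀ W =
        mfderiv IM IN p z₀.proj W.1 := by
      refine (congrArg (fun A : EM × EN →L[ℝ] EN => A W) (mfderiv_comp z₀ hpm hpr)).trans ?_
      exact congrArg (mfderiv IM IN p z₀.proj) (mfderiv_totalSpace_proj z₀ W)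
    exact h.trans (Prod.ext hc rfl)
  have e1 := canonicalSymplecticForm_apply (f z₀)
    (mfderiv (IM.prod 𝓘(ℝ, EN)) (IN.prod 𝓘(ℝ, EN →L[ℝ] ℝ)) f z₀ U)
    (mfderiv (IM.prod 𝓘(ℝ, EN)) (IN.prod 𝓘(ℝ, EN →L[ℝ] ℝ)) f z₀ W)
  replace e1 := e1.trans (congrArg₂
    (fun A B : EN × (EN →L[ℝ] ℝ) => A.2 B.1 - B.2 A.1) (hder U) (hder W))
  have e2 : DiffForm.pullback (IM.prod 𝓘(ℝ, EN)) (IN.prod 𝓘(ℝ, EN →L[ℝ] ℝ)) f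
      (canonicalSymplecticForm IN N) z₀ ![U, W] = canonicalSymplecticForm IN N (f z₀)
        ![mfderiv (IM.prod 𝓘(ℝ, EN)) (IN.prod 𝓘(ℝ, EN →L[ℝ] ℝ)) f z₀ U,
          mfderiv (IM.prod 𝓘(ℝ, EN)) (IN.prod 𝓘(ℝ, EN →L[ℝ] ℝ)) f z₀ W] := by
    refine congrArg (canonicalSymplecticForm IN N (f z₀)) ?_
    ext i : 1
    fin_cases i <;> rfl
  have e3 : DiffForm.pullback (IM.prod 𝓘(ℝ, EN)) IM (fun z : TMN IM IN p => z.proj) β z₀ ![U, W] =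
      β z₀.proj ![U.1, W.1] := by
    refine congrArg (β z₀.proj) ?_
    ext i : 1
    fin_cases i
    · exact mfderiv_totalSpace_proj z₀ U
    · exact mfderiv_totalSpace_proj z₀ W
  exact congrArg₂ (· + ·) (e2.trans e1) e3

omit [IN.Boundaryless] in
/-- The coordinate expression `d E_L = (dP) v - ∂L/∂y dy`: the terms `P dv` coming from `P v` and
from `L` cancel. -/
theorem mfderiv_energy_apply (W : EM × EN) :
    (mfderiv (IM.prod 𝓘(ℝ, EN)) 𝓘(ℝ, ℝ) (energy IM IN p L) z₀ W : ℝ) =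
      fderiv ℝ (momentumInChart L z₀) (extChartAt (IM.prod 𝓘(ℝ, EN)) z₀ z₀) W z₀.2 -
      fderiv ℝ (lagrangianInChart L z₀) (extChartAt (IM.prod 𝓘(ℝ, EN)) z₀ z₀) (W.1, 0) := by
  set u₀ := extChartAt (IM.prod 𝓘(ℝ, EN)) z₀ z₀ with hu₀
  have hu2 : u₀.2 = z₀.2 := by
    rw [hu₀, TMN.extChartAt_apply (mem_chart_source _ _)]
    exact trivializationAt_tangent_self (I := IN) (p z₀.proj) z₀.2
  have hPd : HasFDerivAt (momentumInChart L z₀) (fderiv ℝ (momentumInChart L z₀) u₀) u₀ :=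
    ((contDiffAt_momentumInChart hL
      (mem_extChartAt_target z₀)).differentiableAt (by simp)).hasFDerivAt
  have hLd : HasFDerivAt (lagrangianInChart L z₀) (fderiv ℝ (lagrangianInChart L z₀) u₀) u₀ :=
    ((contDiffAt_lagrangianInChart hL
      (mem_extChartAt_target z₀)).differentiableAt (by simp)).hasFDerivAt
  have hE := (hPd.clm_apply (hasFDerivAt_snd (p := u₀))).sub hLd
  have h := hasMFDerivAt_of_comp_extChartAt (x := z₀) (f := energy IM IN p L) hE (by
    filter_upwards [extChartAt_source_mem_nhds (I := IM.prod 𝓘(ℝ, EN)) z₀] with z hz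
    exact energy_eq_inChart hL hz)
  rw [h.mfderiv]
  have hsplit : fderiv ℝ (lagrangianInChart L z₀) u₀ W =
      fderiv ℝ (lagrangianInChart L z₀) u₀ (W.1, 0) + momentumInChart L z₀ u₀ W.2 := by
    rw [momentumInChart, ContinuousLinearMap.comp_apply, ← map_add]
    simp
  change momentumInChart L z₀ u₀ W.2 + fderiv ℝ (momentumInChart L z₀) u₀ W u₀.2 -
    fderiv ℝ (lagrangianInChart L z₀) u₀ W = _
  rw [hsplit, hu2]
  ring

end PresymplecticLocal

/-! ### The first variation in coordinates -/

section Rectangle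

variable {F : Type*} [NormedAddCommGroup F] [NormedSpace ℝ F] {r a b ε t : ℝ}

/-- The parameter domain of a deformation. -/
def deformationDomain (r a b : ℝ) : Set (ℝ × ℝ) := Ioo (-r) r ×ˢ Icc a b

theorem uniqueDiffOn_deformationDomain (hab : a < b) : UniqueDiffOn ℝ (deformationDomain r a b) :=
  isOpen_Ioo.uniqueDiffOn.prod (uniqueDiffOn_Icc hab)

theorem deformationDomain_subset_closure_interior (hab : a < b) :
    deformationDomain r a b ⊆ closure (interior (deformationDomain r a b)) := by
  rw [deformationDomain, interior_prod_eq, interior_Icc, isOpen_Ioo.interior_eq, closure_prod_eq,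
    closure_Ioo hab.ne]
  exact prod_mono subset_closure subset_rfl

theorem hasDerivAt_fst_slice {f : ℝ × ℝ → F} {f' : ℝ × ℝ →L[ℝ] F}
    (hf : HasFDerivWithinAt f f' (deformationDomain r a b) (ε, t))
    (hε : ε ∈ Ioo (-r) r) (ht : t ∈ Icc a b) :
    HasDerivAt (fun e => f (e, t)) (f' (1, 0)) ε := by
  have h1 : HasDerivWithinAt (fun e : ℝ => (e, t)) ((1 : ℝ), (0 : ℝ)) (Ioo (-r) r) ε :=
    ((hasDerivAt_id ε).prodMk (hasDerivAt_const ε t)).hasDerivWithinAt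
  have h2 : MapsTo (fun e : ℝ => (e, t)) (Ioo (-r) r) (deformationDomain r a b) :=
    fun e he => ⟨he, ht⟩
  exact (hf.comp_hasDerivWithinAt ε h1 h2).hasDerivAt (isOpen_Ioo.mem_nhds hε)

theorem hasDerivWithinAt_snd_slice {f : ℝ × ℝ → F} {f' : ℝ × ℝ →L[ℝ] F}
    (hf : HasFDerivWithinAt f f' (deformationDomain r a b) (ε, t))
    (hε : ε ∈ Ioo (-r) r) :
    HasDerivWithinAt (fun s => f (ε, s)) (f' (0, 1)) (Icc a b) t := by
  have h1 : HasDerivWithinAt (fun s : ℝ => (ε, s)) ((0 : ℝ), (1 : ℝ)) (Icc a b) t :=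
    ((hasDerivAt_const t ε).prodMk (hasDerivAt_id t)).hasDerivWithinAt
  exact hf.comp_hasDerivWithinAt t h1 fun e he => ⟨hε, he⟩

variable {G : Type*} [NormedAddCommGroup G] [NormedSpace ℝ G]

/-- The computation behind the first variation formula:
`d/dε l (y, ∂ₜn) = d/dt (P ∂_ε n) + ∂l/∂y ∂_ε y - (dP/dt) ∂_ε n`, with `P = ∂l/∂v`, by the symmetry
of the second derivative of `n`. Here `y` and `n` stand for the coordinates of a family in `M` and
of its image in `N`. -/
theorem first_variation_in_coordinates (hr : 0 < r) (hab : a < b) (ht : t ∈ Icc a b)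
    {y : ℝ × ℝ → F} {n : ℝ × ℝ → G}
    (hy : ContDiffWithinAt ℝ ∞ y (deformationDomain r a b) (0, t))
    (hn : ContDiffWithinAt ℝ ∞ n (deformationDomain r a b) (0, t))
    {l : F × G → ℝ}
    (hl : ContDiffAt ℝ ∞ l (y (0, t), fderivWithin ℝ n (deformationDomain r a b) (0, t) (0, 1))) :
    let S := deformationDomain r a b
    let nt := fun q => fderivWithin ℝ n S q (0, 1)
    let P := fun u => (fderiv ℝ l u).comp (ContinuousLinearMap.inr ℝ F G)
    let u₀ := (y (0, t), nt (0, t))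
    ∃ d g' : ℝ, HasDerivAt (fun e => l (y (e, t), nt (e, t))) d 0 ∧
      HasDerivWithinAt (fun s => P (y (0, s), nt (0, s)) (fderivWithin ℝ n S (0, s) (1, 0)))
        g' (Icc a b) t ∧
      d = g' + fderiv ℝ l u₀ (fderivWithin ℝ y S (0, t) (1, 0), 0) -
        fderiv ℝ P u₀ (fderivWithin ℝ y S (0, t) (0, 1), fderivWithin ℝ nt S (0, t) (0, 1))
          (fderivWithin ℝ n S (0, t) (1, 0)) := by
  intro S nt P u₀
  have h0 : (0 : ℝ) ∈ Ioo (-r) r := ⟨by linarith, hr⟩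
  have hq : ((0 : ℝ), t) ∈ S := ⟨h0, ht⟩
  have hS : UniqueDiffOn ℝ S := uniqueDiffOn_deformationDomain hab
  have hdn : ContDiffWithinAt ℝ ∞ (fderivWithin ℝ n S) S (0, t) :=
    hn.fderivWithin_right hS (by simp) hq
  have hdn1 : HasFDerivWithinAt (fderivWithin ℝ n S) (fderivWithin ℝ (fderivWithin ℝ n S) S (0, t))
    S (0, t) := (hdn.differentiableWithinAt (by simp)).hasFDerivWithinAt
  have happ : ∀ v : ℝ × ℝ, HasFDerivWithinAt (fun q => fderivWithin ℝ n S q v)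
      ((ContinuousLinearMap.apply ℝ G v).comp (fderivWithin ℝ (fderivWithin ℝ n S) S (0, t))) S
      (0, t) := fun v => (ContinuousLinearMap.apply ℝ G v).hasFDerivAt.comp_hasFDerivWithinAt _ hdn1
  have hnt : fderivWithin ℝ nt S (0, t) =
      (ContinuousLinearMap.apply ℝ G (0, 1)).comp (fderivWithin ℝ (fderivWithin ℝ n S) S (0, t)) :=
    (happ _).fderivWithin (hS _ hq)
  have hy1 : HasFDerivWithinAt y (fderivWithin ℝ y S (0, t)) S (0, t) :=
    (hy.differentiableWithinAt (by simp)).hasFDerivWithinAt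
  have hΦ := hy1.prodMk (happ (0, 1))
  have hl1 : HasFDerivAt l (fderiv ℝ l u₀) u₀ := (hl.differentiableAt (by simp)).hasFDerivAt
  have hP1 : HasFDerivAt P (fderiv ℝ P u₀) u₀ := by
    have : ContDiffAt ℝ ∞ P u₀ := (hl.fderiv_right (m := ∞) (by simp)).clm_comp contDiffAt_const
    exact (this.differentiableAt (by simp)).hasFDerivAt
  -- the partial derivatives `∂_ε ∂ₜ n` and `∂ₜ ∂_ε n` agree, also at the end points of `[a, b]`
  have hsymm := (hn.isSymmSndFDerivWithinAt
    (by simpa using WithTop.coe_le_coe.2 (le_top : (2 : ℕ∞) ≤ ⊤)) hS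
    (deformationDomain_subset_closure_interior hab hq) hq).eq (1, 0) (0, 1)
  have hlΦ := hl1.comp_hasFDerivWithinAt (0, t) hΦ
  have hPΦ := hP1.comp_hasFDerivWithinAt (0, t) hΦ
  refine ⟨_, _, hasDerivAt_fst_slice hlΦ h0 ht,
    hasDerivWithinAt_snd_slice (hPΦ.clm_apply (happ (1, 0))) h0, ?_⟩
  rw [hnt]
  have hsplit : ∀ (x : F) (v : G), fderiv ℝ l u₀ (x, v) = fderiv ℝ l u₀ (x, 0) + P u₀ v := by
    intro x v
    simp only [P, ContinuousLinearMap.comp_apply, ← map_add]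
    simp
  simp only [ContinuousLinearMap.comp_apply, ContinuousLinearMap.prod_apply,
    ContinuousLinearMap.apply_apply, _root_.add_apply, ContinuousLinearMap.flip_apply]
  rw [hsplit, hsymm]
  simp
  ring

end Rectangle

/-! ### Families of curves in a manifold -/

section Families

variable {E : Type*} [NormedAddCommGroup E] [NormedSpace ℝ E]
  {H : Type*} [TopologicalSpace H] {I : ModelWithCorners ℝ E H}
  {M : Type*} [TopologicalSpace M] [ChartedSpace H M] [IsManifold I ∞ M]
  {X : Type*} [NormedAddCommGroup X] [NormedSpace ℝ X]

theorem ContMDiffWithinAt.contDiffWithinAt_extChartAt_comp {f : X → M} {s : Set X} {x : X} {x₀ : M}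
    (hf : ContMDiffWithinAt 𝓘(ℝ, X) I ∞ f s x) (hx : f x ∈ (chartAt H x₀).source) :
    ContDiffWithinAt ℝ ∞ (extChartAt I x₀ ∘ f) s x :=
  contMDiffWithinAt_iff_contDiffWithinAt.1
    ((contMDiffAt_extChartAt' hx).comp_contMDiffWithinAt x hf)

variable {r a b : ℝ} {f : ℝ × ℝ → M}

omit [IsManifold I ∞ M] in
theorem ContMDiffOn.fst_slice
    (hf : ContMDiffOn 𝓘(ℝ, ℝ × ℝ) I ∞ f (deformationDomain r a b)) {q : ℝ × ℝ}
    (hq : q ∈ deformationDomain r a b) :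
    ContMDiffAt 𝓘(ℝ, ℝ) I ∞ (fun e => f (e, q.2)) q.1 := by
  have h1 : ContMDiffWithinAt 𝓘(ℝ, ℝ) 𝓘(ℝ, ℝ × ℝ) ∞ (fun e : ℝ => (e, q.2)) (Ioo (-r) r) q.1 :=
    ((contDiff_id.prodMk contDiff_const).contMDiff _).contMDiffWithinAt
  have h2 : MapsTo (fun e : ℝ => (e, q.2)) (Ioo (-r) r) (deformationDomain r a b) :=
    fun e he => ⟨he, hq.2⟩
  exact ((hf q hq).comp q.1 h1 h2).contMDiffAt (isOpen_Ioo.mem_nhds hq.1)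

omit [IsManifold I ∞ M] in
theorem ContMDiffOn.snd_slice
    (hf : ContMDiffOn 𝓘(ℝ, ℝ × ℝ) I ∞ f (deformationDomain r a b)) {e : ℝ}
    (he : e ∈ Ioo (-r) r) :
    ContMDiffOn 𝓘(ℝ, ℝ) I ∞ (fun s => f (e, s)) (Icc a b) := by
  have h1 : ContMDiffOn 𝓘(ℝ, ℝ) 𝓘(ℝ, ℝ × ℝ) ∞ (fun s : ℝ => (e, s)) (Icc a b) :=
    (contDiff_const.prodMk contDiff_id).contMDiff.contMDiffOn
  exact hf.comp h1 fun s hs => ⟨he, hs⟩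

theorem trivializationAt_velocity (hab : a < b)
    (hf : ContMDiffOn 𝓘(ℝ, ℝ × ℝ) I ∞ f (deformationDomain r a b)) {q : ℝ × ℝ}
    (hq : q ∈ deformationDomain r a b) {x₀ : M} (hx : f q ∈ (chartAt H x₀).source) :
    (trivializationAt E (TangentSpace I) x₀
      ⟨f q, velocity I a b (fun s => f (q.1, s)) q.2⟩).2 =
      fderivWithin ℝ (extChartAt I x₀ ∘ f) (deformationDomain r a b) q (0, 1) := by
  have h1 := trivializationAt_mfderivWithin (x₀ := x₀)
    ((hf.snd_slice hq.1 q.2 hq.2).mdifferentiableWithinAt (by simp))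
    (uniqueDiffOn_Icc hab _ hq.2) hx 1
  refine h1.trans ?_
  have h2 := hasDerivWithinAt_snd_slice (ε := q.1) (t := q.2)
    (((hf q hq).contDiffWithinAt_extChartAt_comp hx).differentiableWithinAt
      (by simp)).hasFDerivWithinAt hq.1
  exact h2.derivWithin (uniqueDiffOn_Icc hab _ hq.2)

theorem trivializationAt_variation
    (hf : ContMDiffOn 𝓘(ℝ, ℝ × ℝ) I ∞ f (deformationDomain r a b)) {t : ℝ}
    (hq : ((0 : ℝ), t) ∈ deformationDomain r a b) {x₀ : M}
    (hx : f (0, t) ∈ (chartAt H x₀).source) :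
    (trivializationAt E (TangentSpace I) x₀ ⟨f (0, t), variation I f t⟩).2 =
      fderivWithin ℝ (extChartAt I x₀ ∘ f) (deformationDomain r a b) (0, t) (1, 0) := by
  have h1 := trivializationAt_mfderivWithin (x₀ := x₀) (s := univ) (f := fun e => f (e, t)) (x := 0)
    ((hf.fst_slice hq).mdifferentiableAt (by simp)).mdifferentiableWithinAt
    uniqueDiffWithinAt_univ hx 1
  rw [mfderivWithin_univ, fderivWithin_univ] at h1
  refine h1.trans ?_
  have h2 := hasDerivAt_fst_slice
    (((hf _ hq).contDiffWithinAt_extChartAt_comp hx).differentiableWithinAt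
      (by simp)).hasFDerivWithinAt hq.1 hq.2
  exact h2.deriv

variable {E' : Type*} [NormedAddCommGroup E'] [NormedSpace ℝ E']
  {H' : Type*} [TopologicalSpace H'] {I' : ModelWithCorners ℝ E' H'}
  {N : Type*} [TopologicalSpace N] [ChartedSpace H' N] {p : M → N}

omit [IsManifold I ∞ M] in
theorem mfderiv_velocity (hab : a < b) {c : ℝ → M} {t : ℝ} (ht : t ∈ Icc a b)
    (hp : MDifferentiableAt I I' p (c t))
    (hc : MDifferentiableWithinAt 𝓘(ℝ, ℝ) I c (Icc a b) t) :
    mfderiv I I' p (c t) (velocity I a b c t) = velocity I' a b (fun s => p (c s)) t :=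
  (congrArg (fun A : ℝ →L[ℝ] E' => A 1)
    (mfderiv_comp_mfderivWithin t hp hc (uniqueDiffOn_Icc hab t ht).uniqueMDiffWithinAt)).symm

omit [IsManifold I ∞ M] in
theorem mfderiv_variation {t : ℝ}
    (hp : MDifferentiableAt I I' p (f (0, t)))
    (hc : MDifferentiableAt 𝓘(ℝ, ℝ) I (fun e => f (e, t)) 0) :
    mfderiv I I' p (f (0, t)) (variation I f t) = variation I' (fun q => p (f q)) t :=
  (congrArg (fun A : ℝ →L[ℝ] E' => A 1) (mfderiv_comp (0 : ℝ) hp hc)).symm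

end Families

/-! ### The pointwise first variation formula -/

section Lift

variable {EM : Type*} [NormedAddCommGroup EM] [NormedSpace ℝ EM]
  {HM : Type*} [TopologicalSpace HM] {IM : ModelWithCorners ℝ EM HM}
  {M : Type*} [TopologicalSpace M] [ChartedSpace HM M]
  {EN : Type*} [NormedAddCommGroup EN] [NormedSpace ℝ EN]
  {HN : Type*} [TopologicalSpace HN] {IN : ModelWithCorners ℝ EN HN}
  {N : Type*} [TopologicalSpace N] [ChartedSpace HN N] [IsManifold IN ∞ N]
  {p : C^∞⟮IM, M; IN, N⟯} [IsManifold IM ∞ M] {r a b : ℝ} {h : ℝ × ℝ → M}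

variable (IM IN p) in
/-- The lifts `(ṅ_ε, m_ε)` of the curves `m_ε = h (ε, ·)` of a family, as a family in `T_M N`. -/
def familyLift (a b : ℝ) (h : ℝ × ℝ → M) (q : ℝ × ℝ) : TMN IM IN p :=
  constrainedLift IM IN p a b (fun s => h (q.1, s)) q.2

omit [IsManifold IM ∞ M] in
/-- The coordinates of the lift are `(y, ∂ₜn)`. -/
theorem extChartAt_familyLift (hab : a < b)
    (hh : ContMDiffOn 𝓘(ℝ, ℝ × ℝ) IM ∞ h (deformationDomain r a b)) {q : ℝ × ℝ}
    (hq : q ∈ deformationDomain r a b) {z₀ : TMN IM IN p}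
    (hx : p (h q) ∈ (chartAt HN (p z₀.proj)).source) :
    extChartAt (IM.prod 𝓘(ℝ, EN)) z₀ (familyLift IM IN p a b h q) =
      (extChartAt IM z₀.proj (h q), fderivWithin ℝ (extChartAt IN (p z₀.proj) ∘ p ∘ h)
        (deformationDomain r a b) q (0, 1)) := by
  refine (TMN.extChartAt_apply (z := familyLift IM IN p a b h q) hx).trans (Prod.ext rfl ?_)
  exact trivializationAt_velocity hab (p.contMDiff.comp_contMDiffOn hh) hq hx

omit [IsManifold IM ∞ M] in
theorem contMDiffOn_familyLift (hab : a < b)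
    (hh : ContMDiffOn 𝓘(ℝ, ℝ × ℝ) IM ∞ h (deformationDomain r a b)) :
    ContMDiffOn 𝓘(ℝ, ℝ × ℝ) (IM.prod 𝓘(ℝ, EN)) ∞ (familyLift IM IN p a b h)
      (deformationDomain r a b) := by
  intro q hq
  have hph : ContMDiffOn 𝓘(ℝ, ℝ × ℝ) IN ∞ (p ∘ h) (deformationDomain r a b) :=
    p.contMDiff.comp_contMDiffOn hh
  refine contMDiffWithinAt_totalSpace.2 ⟨hh q hq, ?_⟩
  have hcd := (((hph q hq).contDiffWithinAt_extChartAt_comp (x₀ := p (h q))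
    (mem_chart_source _ _)).fderivWithin_right (m := ∞)
    (uniqueDiffOn_deformationDomain hab) (by simp) hq).clm_apply
      (contDiffWithinAt_const (c := ((0 : ℝ), (1 : ℝ))))
  refine hcd.contMDiffWithinAt.congr_of_eventuallyEq ?_ ?_
  · filter_upwards [(hph q hq).continuousWithinAt.preimage_mem_nhdsWithin
      (chart_source_mem_nhds HN _), self_mem_nhdsWithin] with q' hq' hq''
    exact trivializationAt_velocity hab hph hq'' hq'
  · exact trivializationAt_velocity hab hph hq (mem_chart_source _ _)

variable (IM IN p) in
/-- The pairing `⟨𝔽₁ L (γ (t)), T p (δm (t))⟩`, whose boundary values appear when the first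
variation of the action is integrated by parts. -/
def boundaryTerm (L : TMN IM IN p → ℝ) (a b : ℝ) (h : ℝ × ℝ → M) (t : ℝ) : ℝ :=
  (coProj IM IN p (legendreMap IM IN p L (familyLift IM IN p a b h (0, t)))).2
    (mfderiv IM IN p (h (0, t)) (variation IM h t))

/-- The coordinate expression `P ∂_ε n` of the boundary term. -/
theorem boundaryTerm_eq_inChart [IM.Boundaryless] {L : TMN IM IN p → ℝ}
    (hL : ContMDiff (IM.prod 𝓘(ℝ, EN)) 𝓘(ℝ, ℝ) ∞ L) (hab : a < b)
    (hh : ContMDiffOn 𝓘(ℝ, ℝ × ℝ) IM ∞ h (deformationDomain r a b)) {t : ℝ}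
    (hq : ((0 : ℝ), t) ∈ deformationDomain r a b) {z₀ : TMN IM IN p}
    (hx : h (0, t) ∈ (chartAt HM z₀.proj).source)
    (hpx : p (h (0, t)) ∈ (chartAt HN (p z₀.proj)).source) :
    boundaryTerm IM IN p L a b h t =
      momentumInChart L z₀ (extChartAt IM z₀.proj (h (0, t)),
        fderivWithin ℝ (extChartAt IN (p z₀.proj) ∘ p ∘ h) (deformationDomain r a b) (0, t) (0, 1))
        (fderivWithin ℝ (extChartAt IN (p z₀.proj) ∘ p ∘ h) (deformationDomain r a b) (0, t)
          (1, 0)) := by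
  have hph : ContMDiffOn 𝓘(ℝ, ℝ × ℝ) IN ∞ (p ∘ h) (deformationDomain r a b) :=
    p.contMDiff.comp_contMDiffOn hh
  have h1 := legendreMap_apply_eq_momentumInChart (z := familyLift IM IN p a b h (0, t)) hL
    (TMN.mem_extChartAt_source.2 ⟨hpx, hx⟩) (mfderiv IM IN p (h (0, t)) (variation IM h t))
  rw [extChartAt_familyLift hab hh hq hpx] at h1
  refine h1.trans (congrArg _ ?_)
  have h2 := mfderiv_variation (f := h) (t := t) (I' := IN)
    (p.contMDiff.mdifferentiableAt (by simp) (x := h (0, t)))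
    ((hh.fst_slice hq).mdifferentiableAt (by simp))
  have h3 := trivializationAt_variation hph hq hpx
  refine Eq.trans ?_ h3
  exact congrArg (fun w : EN => (trivializationAt EN (TangentSpace IN) (p z₀.proj)
    (⟨p (h (0, t)), w⟩ : TangentBundle IN N)).2) h2

omit [IsManifold IN ∞ N] in
theorem variation_eq_fderivWithin
    (hh : ContMDiffOn 𝓘(ℝ, ℝ × ℝ) IM ∞ h (deformationDomain r a b)) {t : ℝ}
    (hq : ((0 : ℝ), t) ∈ deformationDomain r a b) :
    (variation IM h t : EM) = fderivWithin ℝ (extChartAt IM (h (0, t)) ∘ h)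
      (deformationDomain r a b) (0, t) (1, 0) :=
  (trivializationAt_tangent_self (I := IM) (h (0, t)) (variation IM h t)).symm.trans
    (trivializationAt_variation hh hq (mem_chart_source _ _))

omit [IsManifold IN ∞ N] in
theorem velocity_eq_fderivWithin (hab : a < b)
    (hh : ContMDiffOn 𝓘(ℝ, ℝ × ℝ) IM ∞ h (deformationDomain r a b)) {t : ℝ}
    (hq : ((0 : ℝ), t) ∈ deformationDomain r a b) :
    (velocity IM a b (fun s => h (0, s)) t : EM) = fderivWithin ℝ (extChartAt IM (h (0, t)) ∘ h)
      (deformationDomain r a b) (0, t) (0, 1) :=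
  (trivializationAt_tangent_self (I := IM) (h (0, t))
    (velocity IM a b (fun s => h (0, s)) t)).symm.trans
    (trivializationAt_velocity hab hh hq (mem_chart_source _ _))

/-- The coordinates of `γ̇` are `(∂ₜy, ∂ₜ∂ₜn)`. -/
theorem velocity_familyLift (hab : a < b)
    (hh : ContMDiffOn 𝓘(ℝ, ℝ × ℝ) IM ∞ h (deformationDomain r a b)) {t : ℝ}
    (hq : ((0 : ℝ), t) ∈ deformationDomain r a b) :
    (velocity (IM.prod 𝓘(ℝ, EN)) a b (fun s => familyLift IM IN p a b h (0, s)) t : EM × EN) =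
      (fderivWithin ℝ (extChartAt IM (h (0, t)) ∘ h) (deformationDomain r a b) (0, t) (0, 1),
        fderivWithin ℝ (fun q => fderivWithin ℝ (extChartAt IN (p (h (0, t))) ∘ p ∘ h)
          (deformationDomain r a b) q (0, 1)) (deformationDomain r a b) (0, t) (0, 1)) := by
  set S := deformationDomain r a b with hS
  have hph : ContMDiffOn 𝓘(ℝ, ℝ × ℝ) IN ∞ (p ∘ h) S := p.contMDiff.comp_contMDiffOn hh
  have hΓ : ContMDiffOn 𝓘(ℝ, ℝ) (IM.prod 𝓘(ℝ, EN)) ∞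
      (fun s => familyLift IM IN p a b h (0, s)) (Icc a b) :=
    (contMDiffOn_familyLift hab hh).snd_slice hq.1
  refine (mfderivWithin_eq_fderivWithin_extChartAt_comp
    ((hΓ t hq.2).mdifferentiableWithinAt (by simp)) (1 : ℝ)).trans ?_
  have hy : ContDiffWithinAt ℝ ∞ (extChartAt IM (h (0, t)) ∘ h) S (0, t) :=
    (hh _ hq).contDiffWithinAt_extChartAt_comp (mem_chart_source _ _)
  have hn : ContDiffWithinAt ℝ ∞ (fun q => fderivWithin ℝ (extChartAt IN (p (h (0, t))) ∘ p ∘ h)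
      S q (0, 1)) S (0, t) :=
    (((hph _ hq).contDiffWithinAt_extChartAt_comp (x₀ := p (h (0, t)))
      (mem_chart_source _ _)).fderivWithin_right (m := ∞)
      (uniqueDiffOn_deformationDomain hab) (by simp) hq).clm_apply contDiffWithinAt_const
  have hd := hasDerivWithinAt_snd_slice
    ((hy.differentiableWithinAt (by simp)).hasFDerivWithinAt.prodMk
      (hn.differentiableWithinAt (by simp)).hasFDerivWithinAt) hq.1
  have hcongr := hd.congr_of_eventuallyEq (f₁ := extChartAt (IM.prod 𝓘(ℝ, EN))
    (familyLift IM IN p a b h (0, t)) ∘ fun s => familyLift IM IN p a b h (0, s)) ?_ ?_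
  · exact hcongr.derivWithin (uniqueDiffOn_Icc hab t hq.2)
  · filter_upwards [((hph.snd_slice hq.1) t hq.2).continuousWithinAt.preimage_mem_nhdsWithin
      (chart_source_mem_nhds HN _), self_mem_nhdsWithin] with s hs hs'
    exact extChartAt_familyLift (q := (0, s)) hab hh ⟨hq.1, hs'⟩ hs
  · exact extChartAt_familyLift hab hh hq (mem_chart_source _ _)

variable (IM IN p) in
/-- The left-hand side minus the right-hand side of the equation
`i_U ((π̄₁ ∘ 𝔽₁ L)^* ω_N + π₂^* β) = - d E_L` at `z`, evaluated at `W`. -/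
def presymplecticDefect (L : TMN IM IN p → ℝ) (β : DiffForm IM M 2) (z : TMN IM IN p)
    (U W : EM × EN) : ℝ :=
  let dE : EM × EN →L[ℝ] ℝ := mfderiv (IM.prod 𝓘(ℝ, EN)) 𝓘(ℝ, ℝ) (energy IM IN p L) z
  presymplecticForm IM IN p L β z ![U, W] + dE W

/-- The pointwise first variation formula. The family `h` is not required to fix the end points, and
`W` is any tangent vector of `T_M N` over the variation of `h`. -/
theorem first_variation_formula [IM.Boundaryless] [IN.Boundaryless] {L : TMN IM IN p → ℝ}
    (hL : ContMDiff (IM.prod 𝓘(ℝ, EN)) 𝓘(ℝ, ℝ) ∞ L) (β : DiffForm IM M 2) (hr : 0 < r) (hab : a < b)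
    (hh : ContMDiffOn 𝓘(ℝ, ℝ × ℝ) IM ∞ h (deformationDomain r a b)) {t : ℝ} (ht : t ∈ Icc a b)
    (W : EM × EN) (hW : W.1 = variation IM h t) :
    ∃ d g' : ℝ, HasDerivAt (fun e => L (familyLift IM IN p a b h (e, t))) d 0 ∧
      HasDerivWithinAt (boundaryTerm IM IN p L a b h) g' (Icc a b) t ∧
      d + gyroscopicForce IM β (h (0, t)) (velocity IM a b (fun s => h (0, s)) t)
          (variation IM h t) =
        g' - presymplecticDefect IM IN p L β (familyLift IM IN p a b h (0, t))
          (velocity (IM.prod 𝓘(ℝ, EN)) a b (fun s => familyLift IM IN p a b h (0, s)) t) W := by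
  set S := deformationDomain r a b with hS
  have hq : ((0 : ℝ), t) ∈ S := ⟨⟨by linarith, hr⟩, ht⟩
  have hph : ContMDiffOn 𝓘(ℝ, ℝ × ℝ) IN ∞ (p ∘ h) S := p.contMDiff.comp_contMDiffOn hh
  set z₀ := familyLift IM IN p a b h (0, t) with hz₀
  have hproj : z₀.proj = h (0, t) := rfl
  have hy : ContDiffWithinAt ℝ ∞ (extChartAt IM (h (0, t)) ∘ h) S (0, t) :=
    (hh _ hq).contDiffWithinAt_extChartAt_comp (mem_chart_source _ _)
  have hn : ContDiffWithinAt ℝ ∞ (extChartAt IN (p (h (0, t))) ∘ p ∘ h) S (0, t) :=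
    (hph _ hq).contDiffWithinAt_extChartAt_comp (mem_chart_source _ _)
  have hu₀ : extChartAt (IM.prod 𝓘(ℝ, EN)) z₀ z₀ = (extChartAt IM (h (0, t)) (h (0, t)),
      fderivWithin ℝ (extChartAt IN (p (h (0, t))) ∘ p ∘ h) S (0, t) (0, 1)) :=
    extChartAt_familyLift hab hh hq (mem_chart_source _ _)
  have hl : ContDiffAt ℝ ∞ (lagrangianInChart L z₀) (extChartAt (IM.prod 𝓘(ℝ, EN)) z₀ z₀) :=
    contDiffAt_lagrangianInChart hL (mem_extChartAt_target z₀)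
  rw [hu₀] at hl
  obtain ⟨d, g', hd, hg, hdg⟩ := first_variation_in_coordinates hr hab ht hy hn hl
  refine ⟨d, g', hd.congr_of_eventuallyEq ?_, hg.congr_of_eventuallyEq ?_ ?_, ?_⟩
  · have hc : ContinuousAt (fun e => h (e, t)) 0 := (hh.fst_slice hq).continuousAt
    have hcp : ContinuousAt (fun e => p (h (e, t))) 0 := (hph.fst_slice hq).continuousAt
    filter_upwards [hc.preimage_mem_nhds (chart_source_mem_nhds HM _),
      hcp.preimage_mem_nhds (chart_source_mem_nhds HN _), isOpen_Ioo.mem_nhds hq.1] with e h1 h2 h3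
    have he : ((e, t) : ℝ × ℝ) ∈ S := ⟨h3, ht⟩
    rw [← lagrangianInChart_extChartAt (L := L) (z₀ := z₀) (z := familyLift IM IN p a b h (e, t))
      (TMN.mem_extChartAt_source.2 ⟨h2, h1⟩)]
    exact congrArg _ (extChartAt_familyLift hab hh he h2)
  · filter_upwards [((hph.snd_slice hq.1) t hq.2).continuousWithinAt.preimage_mem_nhdsWithin
      (chart_source_mem_nhds HN _), ((hh.snd_slice hq.1) t
      hq.2).continuousWithinAt.preimage_mem_nhdsWithin
      (chart_source_mem_nhds HM _), self_mem_nhdsWithin] with s h1 h2 h3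
    exact boundaryTerm_eq_inChart hL (t := s) hab hh ⟨hq.1, h3⟩ (z₀ := z₀) h2 h1
  · exact boundaryTerm_eq_inChart hL hab hh hq (z₀ := z₀) (mem_chart_source _ _)
      (mem_chart_source _ _)
  · set U : EM × EN :=
      velocity (IM.prod 𝓘(ℝ, EN)) a b (fun s => familyLift IM IN p a b h (0, s)) t with hU
    have hU' := velocity_familyLift (p := p) (IN := IN) hab hh hq
    rw [← hU] at hU'
    have hpm : MDifferentiableAt IM IN p (h (0, t)) := p.contMDiff.mdifferentiableAt (by simp)
    have hU1 : U.1 = velocity IM a b (fun s => h (0, s)) t :=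
      (congrArg Prod.fst hU').trans (velocity_eq_fderivWithin hab hh hq).symm
    -- `T p (γ̇)` projects to `ṅ`, which is the fibre component of `γ`
    have hpU : mfderiv IM IN p (h (0, t)) U.1 = z₀.2 := by
      rw [hU1]
      exact mfderiv_velocity hab ht hpm
        ((hh.snd_slice hq.1 t ht).mdifferentiableWithinAt (by simp))
    have hpW : (mfderiv IM IN p (h (0, t)) W.1 : EN) =
        fderivWithin ℝ (extChartAt IN (p (h (0, t))) ∘ p ∘ h) S (0, t) (1, 0) := by
      rw [hW]
      refine (mfderiv_variation (f := h) hpm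
        ((hh.fst_slice hq).mdifferentiableAt (by simp))).trans ?_
      exact variation_eq_fderivWithin (h := p ∘ h) hph hq
    have hβ : gyroscopicForce IM β (h (0, t)) (velocity IM a b (fun s => h (0, s)) t)
        (variation IM h t) = - β (h (0, t)) ![U.1, W.1] := by
      rw [gyroscopicForce_apply, hU1, hW]
    -- the terms `e4` and `dP (W) v` of `e2` cancel, because `T p (U.1) = v`
    have e1 := presymplecticForm_apply hL z₀ β U W
    have e2 := mfderiv_energy_apply hL z₀ W
    have e3 : presymplecticDefect IM IN p L β z₀ U W = _ := congrArg₂ (fun x y : ℝ => x + y) e1 e2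
    have e4 : fderiv ℝ (momentumInChart L z₀) (extChartAt (IM.prod 𝓘(ℝ, EN)) z₀ z₀) W
        (mfderiv IM IN p z₀.proj U.1) = fderiv ℝ (momentumInChart L z₀)
          (extChartAt (IM.prod 𝓘(ℝ, EN)) z₀ z₀) W z₀.2 := congrArg _ hpU
    have e5 : fderiv ℝ (momentumInChart L z₀) (extChartAt (IM.prod 𝓘(ℝ, EN)) z₀ z₀) U
        (mfderiv IM IN p z₀.proj W.1) = fderiv ℝ (momentumInChart L z₀)
          (extChartAt (IM.prod 𝓘(ℝ, EN)) z₀ z₀) U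
          (fderivWithin ℝ (extChartAt IN (p (h (0, t))) ∘ p ∘ h) S (0, t) (1, 0)) :=
      congrArg _ hpW
    have hW1 : fderivWithin ℝ (extChartAt IM (h (0, t)) ∘ h) S (0, t) (1, 0) = W.1 :=
      (variation_eq_fderivWithin hh hq).symm.trans hW.symm
    have hdg' : d = g' + fderiv ℝ (lagrangianInChart L z₀)
          (extChartAt (IM.prod 𝓘(ℝ, EN)) z₀ z₀) (W.1, 0) -
        fderiv ℝ (momentumInChart L z₀) (extChartAt (IM.prod 𝓘(ℝ, EN)) z₀ z₀) U
          (fderivWithin ℝ (extChartAt IN (p (h (0, t))) ∘ p ∘ h) S (0, t) (1, 0)) := by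
      rw [hu₀, hU', ← hW1]
      exact hdg
    have e6 : β z₀.proj ![U.1, W.1] = β (h (0, t)) ![U.1, W.1] := rfl
    rw [hβ, e3, e4, e5, e6, hdg']
    ring

end Lift

/-! ### Continuity of the work of the force -/

section Regularity

variable {E : Type*} [NormedAddCommGroup E] [NormedSpace ℝ E]
  {H : Type*} [TopologicalSpace H] {I : ModelWithCorners ℝ E H}
  {M : Type*} [TopologicalSpace M] [ChartedSpace H M] [IsManifold I ∞ M]

theorem DiffForm.inChart_extChartAt_apply (β : DiffForm I M 2) {x₀ x : M}
    (hx : x ∈ (chartAt H x₀).source) (v w : TangentSpace I x) :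
    DiffForm.inChart I β x₀ (extChartAt I x₀ x)
      ![(trivializationAt E (TangentSpace I) x₀ ⟨x, v⟩).2,
        (trivializationAt E (TangentSpace I) x₀ ⟨x, w⟩).2] = β x ![v, w] := by
  obtain ⟨z, hz, rfl⟩ : ∃ z ∈ (extChartAt I x₀).target, (extChartAt I x₀).symm z = x :=
    ⟨extChartAt I x₀ x, (extChartAt I x₀).map_source (by simpa using hx),
      (extChartAt I x₀).left_inv (by simpa using hx)⟩
  have hA : ∀ v : TangentSpace I ((extChartAt I x₀).symm z),
      mfderivWithin 𝓘(ℝ, E) I (extChartAt I x₀).symm (range I) z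
        (trivializationAt E (TangentSpace I) x₀ ⟨(extChartAt I x₀).symm z, v⟩).2 = v := by
    intro v
    have h1 : (trivializationAt E (TangentSpace I) x₀ ⟨(extChartAt I x₀).symm z, v⟩).2 =
        mfderiv I 𝓘(ℝ, E) (extChartAt I x₀) ((extChartAt I x₀).symm z) v :=
      (trivializationAt_tangent_eq_continuousLinearMapAt hx v).trans
        (congrArg (fun A : E →L[ℝ] E => A v)
          (TangentBundle.continuousLinearMapAt_trivializationAt hx))
    rw [h1]
    exact congrArg (fun A : E →L[ℝ] E => A v)
      (mfderivWithin_extChartAt_symm_comp_mfderiv_extChartAt hz)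
  rw [(extChartAt I x₀).right_inv hz]
  refine congrArg (β ((extChartAt I x₀).symm z)) ?_
  ext i : 1
  fin_cases i
  · exact hA v
  · exact hA w

variable {r a b : ℝ} {h : ℝ × ℝ → M}

theorem continuousOn_gyroscopicForce [I.Boundaryless] {β : DiffForm I M 2}
    (hβ : DiffForm.IsSmooth I β) (hr : 0 < r) (hab : a < b)
    (hh : ContMDiffOn 𝓘(ℝ, ℝ × ℝ) I ∞ h (deformationDomain r a b)) :
    ContinuousOn (fun t => gyroscopicForce I β (h (0, t))
      (velocity I a b (fun s => h (0, s)) t) (variation I h t)) (Icc a b) := by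
  intro t ht
  set S := deformationDomain r a b with hS
  have h0 : (0 : ℝ) ∈ Ioo (-r) r := ⟨by linarith, hr⟩
  have hq : ((0 : ℝ), t) ∈ S := ⟨h0, ht⟩
  set x₀ := h (0, t) with hx₀
  have hy : ContDiffWithinAt ℝ ∞ (extChartAt I x₀ ∘ h) S (0, t) :=
    (hh _ hq).contDiffWithinAt_extChartAt_comp (mem_chart_source _ _)
  have hdy : ContinuousWithinAt (fderivWithin ℝ (extChartAt I x₀ ∘ h) S) S (0, t) :=
    (hy.fderivWithin_right (m := ∞) (uniqueDiffOn_deformationDomain hab)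
      (by simp) hq).continuousWithinAt
  have hslice : Tendsto (fun s : ℝ => ((0 : ℝ), s)) (𝓝[Icc a b] t) (𝓝[S] (0, t)) := by
    refine tendsto_nhdsWithin_of_tendsto_nhds_of_eventually_within _
      ((Continuous.prodMk_right (0 : ℝ)).continuousAt.tendsto.mono_left nhdsWithin_le_nhds) ?_
    filter_upwards [self_mem_nhdsWithin] with s hs using ⟨h0, hs⟩
  have hβc : ContinuousAt (DiffForm.inChart I β x₀) (extChartAt I x₀ x₀) :=
    (hβ x₀).continuousOn.continuousAt (extChartAt_target_mem_nhds x₀)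
  have hc : ContinuousWithinAt (fun q => DiffForm.inChart I β x₀ ((extChartAt I x₀ ∘ h) q)
      ![fderivWithin ℝ (extChartAt I x₀ ∘ h) S q (0, 1),
        fderivWithin ℝ (extChartAt I x₀ ∘ h) S q (1, 0)]) S (0, t) := by
    have h1 : ContinuousWithinAt (fun q => DiffForm.inChart I β x₀ ((extChartAt I x₀ ∘ h) q))
      S (0, t) :=
      ContinuousAt.comp_continuousWithinAt (g := DiffForm.inChart I β x₀) hβc hy.continuousWithinAt
    refine h1.eval (continuousWithinAt_pi.2 fun i => ?_)
    fin_cases i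
    · exact hdy.clm_apply continuousWithinAt_const
    · exact hdy.clm_apply continuousWithinAt_const
  have hc' := (hc.tendsto.comp hslice).neg
  have heq : ∀ s ∈ Icc a b, h (0, s) ∈ (chartAt H x₀).source →
      gyroscopicForce I β (h (0, s)) (velocity I a b (fun s => h (0, s)) s) (variation I h s) =
      - DiffForm.inChart I β x₀ ((extChartAt I x₀ ∘ h) (0, s))
        ![fderivWithin ℝ (extChartAt I x₀ ∘ h) S (0, s) (0, 1),
          fderivWithin ℝ (extChartAt I x₀ ∘ h) S (0, s) (1, 0)] := by
    intro s hs hx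
    have h1 := trivializationAt_velocity (q := ((0 : ℝ), s)) hab hh ⟨h0, hs⟩ hx
    have h2 := trivializationAt_variation hh ⟨h0, hs⟩ hx
    rw [gyroscopicForce_apply, ← DiffForm.inChart_extChartAt_apply β hx, h2, ← h1]
    rfl
  refine ContinuousWithinAt.congr_of_eventuallyEq
    (f := fun s => - DiffForm.inChart I β x₀ ((extChartAt I x₀ ∘ h) (0, s))
      ![fderivWithin ℝ (extChartAt I x₀ ∘ h) S (0, s) (0, 1),
        fderivWithin ℝ (extChartAt I x₀ ∘ h) S (0, s) (1, 0)]) hc' ?_ ?_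
  · filter_upwards [((hh.snd_slice h0) t ht).continuousWithinAt.preimage_mem_nhdsWithin
      (chart_source_mem_nhds H _), self_mem_nhdsWithin] with s hs hs' using heq s hs' hs
  · exact heq t ht (mem_chart_source _ _)

end Regularity

/-! ### The first variation of the action -/

section ActionVariation

section Calculus

variable {F : Type*} [NormedAddCommGroup F] [NormedSpace ℝ F] {r a b : ℝ}

theorem continuousOn_fst_partial {l : ℝ × ℝ → F} (hab : a < b)
    (hl : ContDiffOn ℝ ∞ l (deformationDomain r a b)) :
    ContinuousOn (fun q => fderivWithin ℝ l (deformationDomain r a b) q (1, 0))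
      (deformationDomain r a b) :=
  (hl.continuousOn_fderivWithin (uniqueDiffOn_deformationDomain hab) (by simp)).clm_apply
    continuousOn_const

theorem mapsTo_snd_slice {e : ℝ} (he : e ∈ Ioo (-r) r) :
    MapsTo (fun t : ℝ => (e, t)) (Icc a b) (deformationDomain r a b) := fun _ ht => ⟨he, ht⟩

/-- Differentiation under the integral sign, on a smaller compact rectangle where the derivative is
bounded. -/
theorem hasDerivAt_integral_family [CompleteSpace F] {l : ℝ × ℝ → F} (hr : 0 < r) (hab : a < b)
    (hl : ContDiffOn ℝ ∞ l (deformationDomain r a b)) :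
    HasDerivAt (fun e => ∫ t in a..b, l (e, t))
      (∫ t in a..b, fderivWithin ℝ l (deformationDomain r a b) (0, t) (1, 0)) 0 := by
  set S := deformationDomain r a b with hS
  have hsub : Icc (-(r / 2)) (r / 2) ×ˢ Icc a b ⊆ S :=
    prod_mono (fun e he => ⟨by linarith [he.1], by linarith [he.2]⟩) subset_rfl
  have hsmall : ∀ e ∈ Ioo (-(r / 2)) (r / 2), e ∈ Ioo (-r) r :=
    fun e he => ⟨by linarith [he.1], by linarith [he.2]⟩
  have hs : Ioo (-(r / 2)) (r / 2) ∈ 𝓝 (0 : ℝ) := Ioo_mem_nhds (by linarith) (by linarith)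
  have hcont : ∀ e ∈ Ioo (-(r / 2)) (r / 2), ContinuousOn (fun t => l (e, t)) (Icc a b) :=
    fun e he => hl.continuousOn.comp (Continuous.prodMk_right e).continuousOn
      (mapsTo_snd_slice (hsmall e he))
  have hdcont : ContinuousOn (fun t => fderivWithin ℝ l S (0, t) (1, 0)) (Icc a b) :=
    (continuousOn_fst_partial hab hl).comp (Continuous.prodMk_right (0 : ℝ)).continuousOn
      (mapsTo_snd_slice (hsmall 0 (mem_of_mem_nhds hs)))
  obtain ⟨C, hC⟩ := (isCompact_Icc.prod isCompact_Icc).exists_bound_of_continuousOn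
    ((continuousOn_fst_partial hab hl).mono hsub)
  have hI : uIoc a b ⊆ Icc a b := by
    rw [uIoc_of_le hab.le]
    exact Ioc_subset_Icc_self
  have hmeas : ∀ f : ℝ → F, ContinuousOn f (Icc a b) →
      AEStronglyMeasurable f (volume.restrict (uIoc a b)) := fun f hf =>
    (hf.mono hI).aestronglyMeasurable measurableSet_uIoc
  refine (intervalIntegral.hasDerivAt_integral_of_dominated_loc_of_deriv_le
    (F := fun e t => l (e, t)) (F' := fun e t => fderivWithin ℝ l S (e, t) (1, 0))
    (bound := fun _ => C) hs ?_ ?_ (hmeas _ hdcont) ?_ ?_ ?_).2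
  · filter_upwards [hs] with e he using hmeas _ (hcont e he)
  · exact (by simpa [uIcc_of_le hab.le] using hcont 0 (mem_of_mem_nhds hs) :
      ContinuousOn _ (uIcc a b)).intervalIntegrable
  · exact Eventually.of_forall fun t ht e he => hC (e, t) ⟨Ioo_subset_Icc_self he, hI ht⟩
  · exact intervalIntegrable_const
  · exact Eventually.of_forall fun t ht e he => hasDerivAt_fst_slice
      ((hl (e, t) ⟨hsmall e he, hI ht⟩).differentiableWithinAt (by simp)).hasFDerivWithinAt
      (hsmall e he) (hI ht)

theorem integral_derivWithin_Icc {g : ℝ → ℝ} (hab : a < b) (hg : ContDiffOn ℝ ∞ g (Icc a b)) :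
    ∫ t in a..b, derivWithin g (Icc a b) t = g b - g a := by
  refine intervalIntegral.integral_eq_sub_of_hasDerivAt_of_le hab.le hg.continuousOn
    (fun t ht => ?_) ?_
  · exact ((hg t (Ioo_subset_Icc_self ht)).differentiableWithinAt
      (by simp)).hasDerivWithinAt.hasDerivAt (Icc_mem_nhds ht.1 ht.2)
  · have := hg.continuousOn_derivWithin (uniqueDiffOn_Icc hab) (by simp)
    exact (by simpa [uIcc_of_le hab.le] using this : ContinuousOn _ (uIcc a b)).intervalIntegrable

end Calculus

variable {EM : Type*} [NormedAddCommGroup EM] [NormedSpace ℝ EM]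
  {HM : Type*} [TopologicalSpace HM] {IM : ModelWithCorners ℝ EM HM}
  {M : Type*} [TopologicalSpace M] [ChartedSpace HM M]
  {EN : Type*} [NormedAddCommGroup EN] [NormedSpace ℝ EN]
  {HN : Type*} [TopologicalSpace HN] {IN : ModelWithCorners ℝ EN HN}
  {N : Type*} [TopologicalSpace N] [ChartedSpace HN N] [IsManifold IN ∞ N]
  {p : C^∞⟮IM, M; IN, N⟯} [IsManifold IM ∞ M] {r a b : ℝ} {h : ℝ × ℝ → M}
  {L : TMN IM IN p → ℝ}

theorem contDiffOn_boundaryTerm [IM.Boundaryless]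
    (hL : ContMDiff (IM.prod 𝓘(ℝ, EN)) 𝓘(ℝ, ℝ) ∞ L) (hr : 0 < r) (hab : a < b)
    (hh : ContMDiffOn 𝓘(ℝ, ℝ × ℝ) IM ∞ h (deformationDomain r a b)) :
    ContDiffOn ℝ ∞ (boundaryTerm IM IN p L a b h) (Icc a b) := by
  intro t ht
  set S := deformationDomain r a b with hS
  have h0 : (0 : ℝ) ∈ Ioo (-r) r := ⟨by linarith, hr⟩
  have hq : ((0 : ℝ), t) ∈ S := ⟨h0, ht⟩
  have hph : ContMDiffOn 𝓘(ℝ, ℝ × ℝ) IN ∞ (p ∘ h) S := p.contMDiff.comp_contMDiffOn hh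
  set z₀ := familyLift IM IN p a b h (0, t) with hz₀
  have hy : ContDiffWithinAt ℝ ∞ (extChartAt IM (h (0, t)) ∘ h) S (0, t) :=
    (hh _ hq).contDiffWithinAt_extChartAt_comp (mem_chart_source _ _)
  have hn : ContDiffWithinAt ℝ ∞ (fderivWithin ℝ (extChartAt IN (p (h (0, t))) ∘ p ∘ h) S) S
      (0, t) :=
    ((hph _ hq).contDiffWithinAt_extChartAt_comp (x₀ := p (h (0, t)))
      (mem_chart_source _ _)).fderivWithin_right (uniqueDiffOn_deformationDomain hab) (by simp) hq
  have hu₀ : extChartAt (IM.prod 𝓘(ℝ, EN)) z₀ z₀ = (extChartAt IM (h (0, t)) (h (0, t)),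
      fderivWithin ℝ (extChartAt IN (p (h (0, t))) ∘ p ∘ h) S (0, t) (0, 1)) :=
    extChartAt_familyLift hab hh hq (mem_chart_source _ _)
  have hP := contDiffAt_momentumInChart hL (mem_extChartAt_target (I := IM.prod 𝓘(ℝ, EN)) z₀)
  rw [hu₀] at hP
  have hc := (hP.comp_contDiffWithinAt ((0 : ℝ), t) (hy.prodMk (hn.clm_apply
    (contDiffWithinAt_const (c := ((0 : ℝ), (1 : ℝ))))))).clm_apply (hn.clm_apply
    (contDiffWithinAt_const (c := ((1 : ℝ), (0 : ℝ)))))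
  have hc' := hc.comp t (contDiff_const.prodMk contDiff_id).contDiffWithinAt (mapsTo_snd_slice h0)
  refine hc'.congr_of_eventuallyEq ?_ ?_
  · filter_upwards [((hph.snd_slice hq.1) t hq.2).continuousWithinAt.preimage_mem_nhdsWithin
      (chart_source_mem_nhds HN _), ((hh.snd_slice hq.1) t
      hq.2).continuousWithinAt.preimage_mem_nhdsWithin
      (chart_source_mem_nhds HM _), self_mem_nhdsWithin] with s h1 h2 h3
    exact boundaryTerm_eq_inChart hL (t := s) hab hh ⟨hq.1, h3⟩ (z₀ := z₀) h2 h1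
  · exact boundaryTerm_eq_inChart hL hab hh hq (z₀ := z₀) (mem_chart_source _ _)
      (mem_chart_source _ _)

omit [IsManifold IM ∞ M] [IsManifold IN ∞ N] in
theorem toTMN_tangentLift (hab : a < b) {m : ℝ → M}
    (hm : ContMDiffOn 𝓘(ℝ, ℝ) IM ∞ m (Icc a b)) {t : ℝ} (ht : t ∈ Icc a b) :
    toTMN IM IN p (tangentLift IM a b m t) = constrainedLift IM IN p a b m t :=
  congrArg (fun v : EN => (⟨m t, v⟩ : TMN IM IN p)) (mfderiv_velocity hab ht
    (p.contMDiff.mdifferentiableAt (by simp)) ((hm t ht).mdifferentiableWithinAt (by simp)))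

variable (IM IN p) in
/-- The defect of the presymplectic equation along the lift of `h (0, ·)`, evaluated on a lift of
the variation `δm` of the family `h`. -/
def variationDefect (L : TMN IM IN p → ℝ) (β : DiffForm IM M 2) (a b : ℝ) (h : ℝ × ℝ → M)
    (t : ℝ) : ℝ :=
  presymplecticDefect IM IN p L β (familyLift IM IN p a b h (0, t))
    (velocity (IM.prod 𝓘(ℝ, EN)) a b (fun s => familyLift IM IN p a b h (0, s)) t)
    ((variation IM h t : EM), 0)

/-- The integrated first variation formula, for families that need not fix the end points. The
continuity of the defect is part of the conclusion since it is read off from the same pointwise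
identity. -/
theorem first_variation_of_action [IM.Boundaryless] [IN.Boundaryless]
    (hL : ContMDiff (IM.prod 𝓘(ℝ, EN)) 𝓘(ℝ, ℝ) ∞ L) {β : DiffForm IM M 2}
    (hβ : DiffForm.IsSmooth IM β) (hr : 0 < r) (hab : a < b)
    (hh : ContMDiffOn 𝓘(ℝ, ℝ × ℝ) IM ∞ h (deformationDomain r a b)) :
    ContinuousOn (variationDefect IM IN p L β a b h) (Icc a b) ∧
    ∃ D : ℝ, HasDerivAt
        (fun e => action IM (L ∘ toTMN IM IN p) a b (fun t => h (e, t))) D 0 ∧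
      D + ∫ t in a..b, gyroscopicForce IM β (h (0, t)) (velocity IM a b (fun s => h (0, s)) t)
          (variation IM h t) =
        boundaryTerm IM IN p L a b h b - boundaryTerm IM IN p L a b h a -
          ∫ t in a..b, variationDefect IM IN p L β a b h t := by
  set S := deformationDomain r a b with hS
  have h0 : (0 : ℝ) ∈ Ioo (-r) r := ⟨by linarith, hr⟩
  set l : ℝ × ℝ → ℝ := fun q => L (familyLift IM IN p a b h q) with hldef
  have hl : ContDiffOn ℝ ∞ l S :=
    contMDiffOn_iff_contDiffOn.1 (hL.comp_contMDiffOn (contMDiffOn_familyLift hab hh))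
  set f := fun t => gyroscopicForce IM β (h (0, t)) (velocity IM a b (fun s => h (0, s)) t)
          (variation IM h t) with hf
  have hfc : ContinuousOn f (Icc a b) := continuousOn_gyroscopicForce hβ hr hab hh
  set g := boundaryTerm IM IN p L a b h with hg
  have hgc : ContDiffOn ℝ ∞ g (Icc a b) := contDiffOn_boundaryTerm hL hr hab hh
  have hg'c := hgc.continuousOn_derivWithin (uniqueDiffOn_Icc hab) (by simp)
  have hdc : ContinuousOn (fun t => fderivWithin ℝ l S (0, t) (1, 0)) (Icc a b) :=
    (continuousOn_fst_partial hab hl).comp (Continuous.prodMk_right (0 : ℝ)).continuousOn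
      (mapsTo_snd_slice h0)
  have hR : ∀ t ∈ Icc a b, variationDefect IM IN p L β a b h t =
      derivWithin g (Icc a b) t - fderivWithin ℝ l S (0, t) (1, 0) - f t := by
    intro t ht
    obtain ⟨d, g', h1, h2, h3⟩ := first_variation_formula (IN := IN) (p := p) hL β hr hab hh ht
      ((variation IM h t : EM), (0 : EN)) rfl
    have h4 := hasDerivAt_fst_slice ((hl (0, t) ⟨h0, ht⟩).differentiableWithinAt
      (by simp)).hasFDerivWithinAt h0 ht
    rw [h2.derivWithin (uniqueDiffOn_Icc hab t ht), h4.unique h1, hf, variationDefect]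
    linarith
  have hint : ∀ f : ℝ → ℝ, ContinuousOn f (Icc a b) → IntervalIntegrable f volume a b :=
    fun f hf =>
      (by simpa [uIcc_of_le hab.le] using hf : ContinuousOn f (uIcc a b)).intervalIntegrable
  refine ⟨((hg'c.sub hdc).sub hfc).congr hR,
    ∫ t in a..b, fderivWithin ℝ l S (0, t) (1, 0), ?_, ?_⟩
  · refine (hasDerivAt_integral_family hr hab hl).congr_of_eventuallyEq ?_
    filter_upwards [isOpen_Ioo.mem_nhds h0] with e he
    refine intervalIntegral.integral_congr fun t ht => ?_
    rw [uIcc_of_le hab.le] at ht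
    exact congrArg L (toTMN_tangentLift hab (hh.snd_slice he) ht)
  · have h5 : ∫ t in a..b, variationDefect IM IN p L β a b h t = ∫ t in a..b,
        (derivWithin g (Icc a b) t - fderivWithin ℝ l S (0, t) (1, 0) - f t) :=
      intervalIntegral.integral_congr fun t ht => hR t (by rwa [uIcc_of_le hab.le] at ht)
    rw [h5, intervalIntegral.integral_sub ((hint _ hg'c).sub (hint _ hdc)) (hint _ hfc),
      intervalIntegral.integral_sub (hint _ hg'c) (hint _ hdc), integral_derivWithin_Icc hab hgc]
    ring

end ActionVariation

/-! ### The fundamental lemma of the calculus of variations -/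

section Fundamental

theorem eqOn_zero_of_integral_contDiff_mul_eq_zero {a b : ℝ} (hab : a < b) {f : ℝ → ℝ}
    (hf : ContinuousOn f (Icc a b))
    (h : ∀ ξ : ℝ → ℝ, ContDiff ℝ ∞ ξ → HasCompactSupport ξ → tsupport ξ ⊆ Ioo a b →
      ∫ t in a..b, ξ t * f t = 0) : ∀ t ∈ Icc a b, f t = 0 := by
  have hae : ∀ᵐ t ∂(volume : Measure ℝ), t ∈ Ioo a b → f t = 0 := by
    refine isOpen_Ioo.ae_eq_zero_of_integral_contDiff_smul_eq_zero
      ((hf.mono Ioo_subset_Icc_self).locallyIntegrableOn measurableSet_Ioo) fun ξ h1 h2 h3 => ?_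
    rw [← h ξ h1 h2 h3, intervalIntegral.integral_of_le hab.le,
      setIntegral_eq_integral_of_forall_compl_eq_zero]
    · rfl
    · intro t ht
      have : ξ t = 0 := image_eq_zero_of_notMem_tsupport
        fun ht' => ht (Ioo_subset_Ioc_self (h3 ht'))
      simp [this]
  have hres : f =ᵐ[volume.restrict (Icc a b)] fun _ => 0 := by
    rw [← Measure.restrict_congr_set Ioo_ae_eq_Icc]
    exact (ae_restrict_iff' measurableSet_Ioo).2 hae
  exact fun t ht => Measure.eqOn_Icc_of_ae_eq volume hab.ne hres hf continuousOn_const ht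

end Fundamental

/-! ### Families with a prescribed variation at one time -/

section Existence
variable {EM : Type*} [NormedAddCommGroup EM] [NormedSpace ℝ EM]
  {HM : Type*} [TopologicalSpace HM] {IM : ModelWithCorners ℝ EM HM}
  {M : Type*} [TopologicalSpace M] [ChartedSpace HM M] [IsManifold IM ∞ M]

/-- The family is `φ⁻¹ (φ (m t) + ε χ(t) η)` in a chart `φ` near `t₀`, with a bump function `χ`
around `t₀`, and it is constant in `ε` elsewhere. -/
theorem exists_family_with_variation [IM.Boundaryless] {m : ℝ → M} {a b : ℝ}
    (hm : ContMDiffOn 𝓘(ℝ, ℝ) IM ∞ m (Icc a b))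
    {t₀ : ℝ} (ht₀ : t₀ ∈ Icc a b) (η : EM) :
    ∃ r > 0, ∃ h : ℝ × ℝ → M, ContMDiffOn 𝓘(ℝ, ℝ × ℝ) IM ∞ h (deformationDomain r a b) ∧
      (∀ t ∈ Icc a b, h (0, t) = m t) ∧ (variation IM h t₀ : EM) = η := by
  set φ := extChartAt IM (m t₀) with hφ
  obtain ⟨ρ', hρ', hball'⟩ := Metric.mem_nhds_iff.1 (extChartAt_target_mem_nhds (I := IM) (m t₀))
  -- room for both the displacement of `m` and the perturbation
  obtain ⟨ρ, hρ, hball⟩ : ∃ ρ > 0, Metric.ball (φ (m t₀)) (ρ + ρ) ⊆ φ.target :=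
    ⟨ρ' / 2, half_pos hρ', by rw [add_halves]; exact hball'⟩
  have hcont : ContinuousWithinAt (fun t => φ (m t)) (Icc a b) t₀ :=
    (continuousAt_extChartAt (I := IM) (m t₀)).comp_continuousWithinAt
      (hm t₀ ht₀).continuousWithinAt
  have hnear : ∀ᶠ t in 𝓝[Icc a b] t₀, m t ∈ (chartAt HM (m t₀)).source ∧
      φ (m t) ∈ Metric.ball (φ (m t₀)) ρ :=
    inter_mem
      ((hm t₀ ht₀).continuousWithinAt.preimage_mem_nhdsWithin (chart_source_mem_nhds HM _))
      (hcont.preimage_mem_nhdsWithin (Metric.ball_mem_nhds _ hρ))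
  obtain ⟨δ, hδ, hδm⟩ := Metric.mem_nhdsWithin_iff.1 hnear
  let χ : ContDiffBump t₀ := ⟨δ / 4, δ / 2, by positivity, by linarith⟩
  -- `|ε| < r` makes the perturbation `ε χ(t) η` smaller than `ρ`
  set r := ρ / (‖η‖ + 1) with hr
  have hη : 0 < ‖η‖ + 1 := by positivity
  have hr0 : 0 < r := div_pos hρ hη
  set y : ℝ × ℝ → EM := fun q => φ (m q.2) + (q.1 * χ q.2) • η with hy
  set h : ℝ × ℝ → M := fun q => if dist q.2 t₀ < δ then φ.symm (y q) else m q.2 with hh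
  have hytarget : ∀ q ∈ deformationDomain r a b, dist q.2 t₀ < δ → y q ∈ φ.target := by
    intro q hq hd
    apply hball
    have h1 := (hδm ⟨hd, hq.2⟩).2
    have h2 : ‖(q.1 * χ q.2) • η‖ < ρ := by
      have h3 : |q.1| < r := abs_lt.2 hq.1
      have h4 : |χ q.2| ≤ 1 := abs_le.2 ⟨by linarith [χ.nonneg (x := q.2)], χ.le_one⟩
      have h5 : |q.1| * |χ q.2| ≤ |q.1| := mul_le_of_le_one_right (abs_nonneg _) h4
      have h6 : |q.1| * (‖η‖ + 1) < ρ := (lt_div_iff₀ hη).1 h3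
      rw [norm_smul, Real.norm_eq_abs, abs_mul]
      nlinarith [norm_nonneg η, abs_nonneg q.1]
    rw [Metric.mem_ball, dist_eq_norm] at h1 ⊢
    calc ‖φ (m q.2) + (q.1 * χ q.2) • η - φ (m t₀)‖
        = ‖(φ (m q.2) - φ (m t₀)) + (q.1 * χ q.2) • η‖ := by congr 1; abel
      _ ≤ _ := norm_add_le _ _
      _ < ρ + ρ := add_lt_add h1 h2
  have hzero : ∀ q : ℝ × ℝ, q.2 ∈ Icc a b → q.1 * χ q.2 = 0 → h q = m q.2 := by
    intro q hq h0
    by_cases hd : dist q.2 t₀ < δ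
    · have h1 := (hδm ⟨hd, hq⟩).1
      simp only [hh, if_pos hd, hy, h0, zero_smul, add_zero]
      exact φ.left_inv (by simpa [hφ] using h1)
    · simp only [hh, if_neg hd]
  have hsmooth : ContMDiffOn 𝓘(ℝ, ℝ × ℝ) IM ∞ h (deformationDomain r a b) := by
    intro q hq
    have hm2 : ContMDiffWithinAt 𝓘(ℝ, ℝ × ℝ) IM ∞ (fun q : ℝ × ℝ => m q.2)
        (deformationDomain r a b) q :=
      (hm q.2 hq.2).comp q (contDiff_snd.contMDiff q).contMDiffWithinAt fun q' hq' => hq'.2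
    by_cases hd : dist q.2 t₀ < δ
    · have hφm := hm2.contDiffWithinAt_extChartAt_comp (hδm ⟨hd, hq.2⟩).1
      have hχ : ContDiff ℝ ∞ fun q : ℝ × ℝ => (q.1 * χ q.2) • η :=
        (contDiff_fst.mul (χ.contDiff.comp contDiff_snd)).smul contDiff_const
      have hyd : ContDiffWithinAt ℝ ∞ y (deformationDomain r a b) q :=
        hφm.add hχ.contDiffWithinAt
      have hsymm : ContMDiffAt 𝓘(ℝ, EM) IM ∞ φ.symm (y q) :=
        (contMDiffOn_extChartAt_symm (m t₀) _ (hytarget q hq hd)).contMDiffAt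
          (extChartAt_target_mem_nhds' (hytarget q hq hd))
      refine (hsymm.comp_contMDiffWithinAt q hyd.contMDiffWithinAt).congr_of_eventuallyEq ?_
        (if_pos hd)
      have : ∀ᶠ q' : ℝ × ℝ in 𝓝 q, dist q'.2 t₀ < δ :=
        (isOpen_lt (by fun_prop) continuous_const).mem_nhds hd
      filter_upwards [nhdsWithin_le_nhds this] with q' hq' using if_pos hq'
    · have hχ0 : ∀ s : ℝ, δ / 2 < dist s t₀ → χ s = 0 := fun s hs => χ.zero_of_le_dist hs.le
      have hq2 : δ / 2 < dist q.2 t₀ := by linarith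
      refine hm2.congr_of_eventuallyEq ?_ (hzero q hq.2 (by rw [hχ0 _ hq2, mul_zero]))
      have : ∀ᶠ q' : ℝ × ℝ in 𝓝 q, δ / 2 < dist q'.2 t₀ :=
        (isOpen_lt continuous_const (by fun_prop)).mem_nhds hq2
      filter_upwards [nhdsWithin_le_nhds this, self_mem_nhdsWithin] with q' h1 h2 using
        hzero q' h2.2 (by rw [hχ0 _ h1, mul_zero])
  refine ⟨r, hr0, h, hsmooth, fun t ht => hzero (0, t) ht (zero_mul _), ?_⟩
  have h0 : (0 : ℝ) ∈ Ioo (-r) r := ⟨by linarith, hr0⟩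
  have hq : ((0 : ℝ), t₀) ∈ deformationDomain r a b := ⟨h0, ht₀⟩
  have hm0 : h (0, t₀) = m t₀ := hzero (0, t₀) ht₀ (zero_mul _)
  have h1 : (variation IM h t₀ : EM) =
      fderivWithin ℝ (φ ∘ h) (deformationDomain r a b) (0, t₀) (1, 0) :=
    (variation_eq_fderivWithin hsmooth hq).trans (congrArg (fun x => fderivWithin ℝ
      (extChartAt IM x ∘ h) (deformationDomain r a b) (0, t₀) (1, 0)) hm0)
  have h2 := hasDerivAt_fst_slice (((hsmooth _ hq).contDiffWithinAt_extChartAt_comp (x₀ := m t₀)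
    (by rw [hm0]; exact mem_chart_source _ _)).differentiableWithinAt
      (by simp)).hasFDerivWithinAt h0 ht₀
  have h3 : HasDerivAt (fun e : ℝ => φ (m t₀) + e • η) η 0 := by
    simpa using ((hasDerivAt_id (0 : ℝ)).smul_const η).const_add (φ (m t₀))
  refine h1.trans (h2.unique (h3.congr_of_eventuallyEq ?_))
  filter_upwards [isOpen_Ioo.mem_nhds h0] with e he
  have hd : dist t₀ t₀ < δ := by simpa using hδ
  have hχ1 : χ t₀ = 1 := χ.one_of_mem_closedBall (Metric.mem_closedBall_self χ.rIn_pos.le)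
  have hye : y (e, t₀) = φ (m t₀) + e • η := by simp [hy, hχ1]
  have : h (e, t₀) = φ.symm (y (e, t₀)) := if_pos hd
  rw [← hye]
  change φ (h (e, t₀)) = _
  rw [this, φ.right_inv (hytarget _ ⟨he, ht₀⟩ hd)]

end Existence

/-! ### Critical curves and solutions of the presymplectic equation -/

section Criticality

variable {EM : Type*} [NormedAddCommGroup EM] [NormedSpace ℝ EM]
  {HM : Type*} [TopologicalSpace HM] {IM : ModelWithCorners ℝ EM HM}
  {M : Type*} [TopologicalSpace M] [ChartedSpace HM M]
  {EN : Type*} [NormedAddCommGroup EN] [NormedSpace ℝ EN]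
  {HN : Type*} [TopologicalSpace HN] {IN : ModelWithCorners ℝ EN HN}
  {N : Type*} [TopologicalSpace N] [ChartedSpace HN N] [IsManifold IN ∞ N]
  {p : C^∞⟮IM, M; IN, N⟯} {r a b t : ℝ} {h : ℝ × ℝ → M}
  {L : TMN IM IN p → ℝ}

omit [IsManifold IN ∞ N] in
theorem velocity_congr {c c' : ℝ → M} (hc : EqOn c c' (Icc a b)) (ht : t ∈ Icc a b) :
    (velocity IM a b c t : EM) = velocity IM a b c' t :=
  congrArg (fun A : ℝ →L[ℝ] EM => A 1) (mfderivWithin_congr hc (hc ht))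

omit [IsManifold IN ∞ N] in
theorem constrainedLift_congr {c c' : ℝ → M} (hc : EqOn c c' (Icc a b)) (ht : t ∈ Icc a b) :
    constrainedLift IM IN p a b c t = constrainedLift IM IN p a b c' t := by
  have h1 : c t = c' t := hc ht
  have h2 : (velocity IN a b (fun s => p (c s)) t : EN) = velocity IN a b (fun s => p (c' s)) t :=
    velocity_congr (fun s hs => congrArg p (hc hs)) ht
  have h3 : ∀ (x x' : M) (v v' : EN), x = x' → v = v' →
      (⟨x, v⟩ : TMN IM IN p) = ⟨x', v'⟩ := by
    rintro x _ v _ rfl rfl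
    rfl
  exact h3 _ _ _ _ h1 h2

theorem solvesPresymplecticEquation_iff {β : DiffForm IM M 2} {γ : ℝ → TMN IM IN p} :
    SolvesPresymplecticEquation IM IN p L β a b γ ↔
      ContMDiffOn 𝓘(ℝ, ℝ) (IM.prod 𝓘(ℝ, EN)) ∞ γ (Icc a b) ∧
      ∀ t ∈ Icc a b, ∀ W : EM × EN, presymplecticDefect IM IN p L β (γ t)
        (velocity (IM.prod 𝓘(ℝ, EN)) a b γ t) W = 0 :=
  and_congr_right fun _ => forall₂_congr fun _ _ => forall_congr' fun _ =>
    (eq_neg_iff_add_eq_zero (G := ℝ))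

theorem presymplecticDefect_congr {β : DiffForm IM M 2} {γ γ' : ℝ → TMN IM IN p}
    (hγ : EqOn γ γ' (Icc a b)) (ht : t ∈ Icc a b) (W : EM × EN) :
    presymplecticDefect IM IN p L β (γ t) (velocity (IM.prod 𝓘(ℝ, EN)) a b γ t) W =
      presymplecticDefect IM IN p L β (γ' t) (velocity (IM.prod 𝓘(ℝ, EN)) a b γ' t) W :=
  congrArg₂ (fun (z : TMN IM IN p) (U : EM × EN) => presymplecticDefect IM IN p L β z U W)
    (hγ ht) (velocity_congr hγ ht)

omit [IsManifold IN ∞ N] in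
theorem variation_eq_zero_of_eventually_const {x : M} (hx : ∀ᶠ e in 𝓝 (0 : ℝ), h (e, t) = x) :
    variation IM h t = 0 := by
  have h1 : (fun e => h (e, t)) =ᶠ[𝓝 0] fun _ => x := hx
  have h2 := h1.mfderiv_eq (I := 𝓘(ℝ, ℝ)) (I' := IM)
  exact (congrArg (fun A : ℝ →L[ℝ] EM => A 1) (h2.trans mfderiv_const))

omit [IsManifold IN ∞ N] in
theorem boundaryTerm_eq_zero {x : M} (hx : ∀ᶠ e in 𝓝 (0 : ℝ), h (e, t) = x) :
    boundaryTerm IM IN p L a b h t = 0 := by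
  rw [boundaryTerm, variation_eq_zero_of_eventually_const hx]
  exact (congrArg _ (ContinuousLinearMap.map_zero _)).trans (ContinuousLinearMap.map_zero _)

variable [IsManifold IM ∞ M]

/-- With fixed end points, the boundary terms vanish. -/
theorem isDeformation_integral [IM.Boundaryless] [IN.Boundaryless]
    (hL : ContMDiff (IM.prod 𝓘(ℝ, EN)) 𝓘(ℝ, ℝ) ∞ L) {β : DiffForm IM M 2}
    (hβ : DiffForm.IsSmooth IM β) (hab : a < b) {m : ℝ → M} (hd : IsDeformation IM a b m r h) :
    DifferentiableAt ℝ (fun e => action IM (L ∘ toTMN IM IN p) a b (fun t => h (e, t))) 0 ∧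
      deriv (fun e => action IM (L ∘ toTMN IM IN p) a b (fun t => h (e, t))) 0 +
        ∫ t in a..b, gyroscopicForce IM β (h (0, t)) (velocity IM a b (fun s => h (0, s)) t)
          (variation IM h t) = - ∫ t in a..b, variationDefect IM IN p L β a b h t := by
  obtain ⟨-, D, hD, hsum⟩ := first_variation_of_action (p := p) (IN := IN) hL hβ hd.pos
    hab hd.smooth
  have hn : Ioo (-r) r ∈ 𝓝 (0 : ℝ) := Ioo_mem_nhds (by linarith [hd.pos]) hd.pos
  have ha : boundaryTerm IM IN p L a b h a = 0 :=
    boundaryTerm_eq_zero (by filter_upwards [hn] with e he using hd.left e he)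
  have hb : boundaryTerm IM IN p L a b h b = 0 :=
    boundaryTerm_eq_zero (by filter_upwards [hn] with e he using hd.right e he)
  refine ⟨hD.differentiableAt, ?_⟩
  rw [hD.deriv, hsum, ha, hb]
  ring

theorem isConstrainedCriticalCurve_of_solves [IM.Boundaryless] [IN.Boundaryless]
    (hL : ContMDiff (IM.prod 𝓘(ℝ, EN)) 𝓘(ℝ, ℝ) ∞ L) {β : DiffForm IM M 2}
    (hβ : DiffForm.IsSmooth IM β) (hab : a < b) {γ : ℝ → TMN IM IN p}
    (hγ : SolvesPresymplecticEquation IM IN p L β a b γ)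
    (hlift : ∀ t ∈ Icc a b, γ t = constrainedLift IM IN p a b (fun s => (γ s).proj) t) :
    IsConstrainedCriticalCurve IM IN p L (gyroscopicForce IM β) a b (fun t => (γ t).proj) := by
  obtain ⟨hs, heq⟩ := solvesPresymplecticEquation_iff.1 hγ
  refine ⟨(contMDiff_proj _).comp_contMDiffOn hs, fun r h hd => ?_⟩
  obtain ⟨h1, h2⟩ := isDeformation_integral (p := p) (IN := IN) hL hβ hab hd
  refine ⟨h1, h2.trans ?_⟩
  have hΓ : EqOn (fun s => familyLift IM IN p a b h (0, s)) γ (Icc a b) := fun t ht =>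
    (constrainedLift_congr (fun s hs => hd.zero s hs) ht).trans (hlift t ht).symm
  rw [neg_eq_zero, intervalIntegral.integral_congr (g := fun _ => (0 : ℝ)),
    intervalIntegral.integral_zero]
  intro t ht
  rw [uIcc_of_le hab.le] at ht
  exact (presymplecticDefect_congr hΓ ht _).trans (heq t ht _)

omit [IsManifold IM ∞ M] in
theorem presymplecticDefect_smul {β : DiffForm IM M 2} (z : TMN IM IN p) (U W : EM × EN) (c : ℝ) :
    presymplecticDefect IM IN p L β z U (c • W) = c * presymplecticDefect IM IN p L β z U W := by
  have key : ∀ (η : (EM × EN) [⋀^Fin 2]→L[ℝ] ℝ) (A : EM × EN →L[ℝ] ℝ),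
      η ![U, c • W] + A (c • W) = c * (η ![U, W] + A W) := by
    intro η A
    have h1 : ∀ V : EM × EN, Function.update ![U, W] 1 V = ![U, V] := by
      intro V
      ext i : 1
      fin_cases i <;> simp
    have h2 := η.map_update_smul ![U, W] 1 c W
    rw [h1, h1] at h2
    rw [h2, map_smul, smul_eq_mul, smul_eq_mul, mul_add]
  exact key _ _

omit [IsManifold IN ∞ N] [IsManifold IM ∞ M] in
theorem variation_rescale (ξ : ℝ → ℝ) (hh : MDifferentiableAt 𝓘(ℝ, ℝ) IM (fun e => h (e, t)) 0) :
    (variation IM (fun q => h (q.1 * ξ q.2, q.2)) t : EM) = ξ t • (variation IM h t : EM) := by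
  have h1 : HasMFDerivAt 𝓘(ℝ, ℝ) 𝓘(ℝ, ℝ) (fun e : ℝ => e * ξ t) 0
      (ContinuousLinearMap.toSpanSingleton ℝ (1 * ξ t)) :=
    ((hasDerivAt_id (0 : ℝ)).mul_const (ξ t)).hasFDerivAt.hasMFDerivAt
  have h2 := mfderiv_comp_of_eq (I := 𝓘(ℝ, ℝ)) (I' := 𝓘(ℝ, ℝ)) (I'' := IM) (x := (0 : ℝ))
    (g := fun e => h (e, t)) hh h1.mdifferentiableAt (zero_mul (ξ t))
  refine (congrArg (fun A : ℝ →L[ℝ] EM => A 1) h2).trans ?_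
  have key : ∀ (A : ℝ → ℝ →L[ℝ] EM) (B : ℝ →L[ℝ] ℝ) (s : ℝ), s = 0 → B 1 = ξ t →
      (A s).comp B 1 = ξ t • A 0 1 := by
    rintro A B _ rfl hB
    rw [ContinuousLinearMap.comp_apply, hB, ← map_smul, smul_eq_mul, mul_one]
  refine key (fun s => mfderiv 𝓘(ℝ, ℝ) IM (fun e => h (e, t)) s) _ _ (zero_mul (ξ t)) ?_
  refine (congrArg (fun A : ℝ →L[ℝ] ℝ => A 1) h1.mfderiv).trans ?_
  exact (one_smul ℝ _).trans (one_mul (ξ t))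

/-- Along a critical curve, the defect vanishes on the variation of every family through the curve,
whether or not the family fixes the end points. -/
theorem variationDefect_eq_zero [IM.Boundaryless] [IN.Boundaryless]
    (hL : ContMDiff (IM.prod 𝓘(ℝ, EN)) 𝓘(ℝ, ℝ) ∞ L) {β : DiffForm IM M 2}
    (hβ : DiffForm.IsSmooth IM β) (hab : a < b) {m : ℝ → M}
    (hm : IsConstrainedCriticalCurve IM IN p L (gyroscopicForce IM β) a b m) (hr : 0 < r)
    (hh : ContMDiffOn 𝓘(ℝ, ℝ × ℝ) IM ∞ h (deformationDomain r a b))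
    (hm0 : ∀ t ∈ Icc a b, h (0, t) = m t) :
    ∀ t ∈ Icc a b, variationDefect IM IN p L β a b h t = 0 := by
  refine eqOn_zero_of_integral_contDiff_mul_eq_zero hab
    (first_variation_of_action hL hβ hr hab hh).1 fun ξ hξ hξc hξs => ?_
  obtain ⟨C, hC⟩ := hξc.exists_bound_of_continuous hξ.continuous
  have hC0 : 0 ≤ C := (norm_nonneg _).trans (hC 0)
  have hξ0 : ∀ s, s ∉ Ioo a b → ξ s = 0 := fun s hs =>
    image_eq_zero_of_notMem_tsupport fun hs' => hs (hξs hs')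
  have h00 : (0 : ℝ) ∈ Ioo (-r) r := ⟨by linarith, hr⟩
  set h' : ℝ × ℝ → M := fun q => h (q.1 * ξ q.2, q.2) with hh'
  -- `|ξ| ≤ C`, so that `|ε| < r / (C + 1)` implies `|ε ξ(t)| < r`
  have hd : IsDeformation IM a b m (r / (C + 1)) h' := by
    refine ⟨by positivity, ?_, fun t ht => ?_, fun e _ => ?_, fun e _ => ?_⟩
    · have hρ : ContDiff ℝ ∞ fun q : ℝ × ℝ => (q.1 * ξ q.2, q.2) :=
        (contDiff_fst.mul (hξ.comp contDiff_snd)).prodMk contDiff_snd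
      refine hh.comp hρ.contMDiff.contMDiffOn fun q hq => ⟨abs_lt.1 ?_, hq.2⟩
      have h1 : |q.1| * (C + 1) < r := (lt_div_iff₀ (by positivity)).1 (abs_lt.2 hq.1)
      have h2 : |ξ q.2| ≤ C := hC q.2
      rw [abs_mul]
      nlinarith [abs_nonneg q.1]
    · simp only [hh', zero_mul]
      exact hm0 t ht
    · simp only [hh', hξ0 a (by simp), mul_zero]
      exact hm0 a (left_mem_Icc.2 hab.le)
    · simp only [hh', hξ0 b (by simp), mul_zero]
      exact hm0 b (right_mem_Icc.2 hab.le)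
  have h1 := (isDeformation_integral (p := p) (IN := IN) hL hβ hab hd).2.symm.trans (hm.2 _ h' hd).2
  rw [neg_eq_zero] at h1
  rw [← h1]
  refine intervalIntegral.integral_congr fun t ht => ?_
  rw [uIcc_of_le hab.le] at ht
  have hΓ : EqOn (fun s => familyLift IM IN p a b h' (0, s))
      (fun s => familyLift IM IN p a b h (0, s)) (Icc a b) := fun s hs =>
    constrainedLift_congr (fun s _ => by simp only [hh', zero_mul]) hs
  have hv := variation_rescale (t := t) ξ
    ((hh.fst_slice (q := (0, t)) ⟨h00, ht⟩).mdifferentiableAt (by simp))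
  have hW : (((variation IM h' t : EM), 0) : EM × EN) = ξ t • ((variation IM h t : EM), (0 : EN)) :=
    Prod.ext hv (smul_zero _).symm
  exact ((presymplecticDefect_congr hΓ ht _).trans
    ((congrArg _ hW).trans (presymplecticDefect_smul _ _ _ _))).symm

theorem solves_of_isConstrainedCriticalCurve [IM.Boundaryless] [IN.Boundaryless]
    (hL : ContMDiff (IM.prod 𝓘(ℝ, EN)) 𝓘(ℝ, ℝ) ∞ L) {β : DiffForm IM M 2}
    (hβ : DiffForm.IsSmooth IM β) (hab : a < b) {m : ℝ → M}
    (hm : IsConstrainedCriticalCurve IM IN p L (gyroscopicForce IM β) a b m) :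
    SolvesPresymplecticEquation IM IN p L β a b (constrainedLift IM IN p a b m) := by
  have hms : ContMDiffOn 𝓘(ℝ, ℝ) IM ∞ m (Icc a b) := hm.1
  -- the constant family shows that the lift of `m` is smooth
  have hconst : ContMDiffOn 𝓘(ℝ, ℝ × ℝ) IM ∞ (fun q : ℝ × ℝ => m q.2) (deformationDomain 1 a b) :=
    hms.comp (contDiff_snd.contMDiff.contMDiffOn) fun q hq => hq.2
  refine solvesPresymplecticEquation_iff.2
    ⟨(contMDiffOn_familyLift hab hconst).snd_slice (e := 0) (by norm_num), fun t ht W => ?_⟩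
  obtain ⟨r, hr, h, hh, hm0, hv⟩ := exists_family_with_variation hms ht W.1
  obtain ⟨d, g', h1, h2, h3⟩ := first_variation_formula (IN := IN) (p := p) hL β hr hab hh
    ht W hv.symm
  -- the left-hand side and `d/dt (P δn)` do not depend on the lift of `δm`, hence neither does the
  -- defect, and it suffices to know it for the lift `(δm, 0)`
  obtain ⟨d', g'', h1', h2', h3'⟩ := first_variation_formula (IN := IN) (p := p) hL β hr hab hh ht
    ((variation IM h t : EM), 0) rfl
  have hd : d = d' := h1.unique h1'
  have hg : g' = g'' := (h2.derivWithin (uniqueDiffOn_Icc hab t ht)).symm.trans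
    (h2'.derivWithin (uniqueDiffOn_Icc hab t ht))
  have h0 := variationDefect_eq_zero (IN := IN) (p := p) hL hβ hab hm hr hh hm0 t ht
  have hΓ : EqOn (constrainedLift IM IN p a b m)
      (fun s => familyLift IM IN p a b h (0, s)) (Icc a b) := fun s hs =>
    constrainedLift_congr (fun s hs => (hm0 s hs).symm) hs
  refine (presymplecticDefect_congr hΓ ht W).trans ?_
  rw [variationDefect] at h0
  rw [h0, sub_zero] at h3'
  linarith

end Criticality

end

theorem mainTheorem7
    {EM : Type*} [NormedAddCommGroup EM] [NormedSpace ℝ EM] [FiniteDimensional ℝ EM]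
    {HM : Type*} [TopologicalSpace HM] (IM : ModelWithCorners ℝ EM HM) [IM.Boundaryless]
    {M : Type*} [TopologicalSpace M] [T2Space M] [SecondCountableTopology M]
    [ChartedSpace HM M] [IsManifold IM ∞ M]
    {EN : Type*} [NormedAddCommGroup EN] [NormedSpace ℝ EN] [FiniteDimensional ℝ EN]
    {HN : Type*} [TopologicalSpace HN] (IN : ModelWithCorners ℝ EN HN) [IN.Boundaryless]
    {N : Type*} [TopologicalSpace N] [T2Space N] [SecondCountableTopology N]
    [ChartedSpace HN N] [IsManifold IN ∞ N]
    (p : C^∞⟮IM, M; IN, N⟯) (hp : IsFibredManifold IM IN p)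
    (L : TMN IM IN p → ℝ) (hL : ContMDiff (IM.prod 𝓘(ℝ, EN)) 𝓘(ℝ, ℝ) ∞ L)
    (β : DiffForm IM M 2) (hβ : DiffForm.IsSmooth IM β) (hβ_closed : DiffForm.d IM β = 0)
    (a b : ℝ) (hab : a < b) :
    (∀ m : ℝ → M,
      IsConstrainedCriticalCurve IM IN p L (gyroscopicForce IM β) a b m →
        SolvesPresymplecticEquation IM IN p L β a b (constrainedLift IM IN p a b m)) ∧
    (∀ γ : ℝ → TMN IM IN p,
      SolvesPresymplecticEquation IM IN p L β a b γ →
      (∀ t ∈ Icc a b, γ t = constrainedLift IM IN p a b (fun s => (γ s).proj) t) →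
        IsConstrainedCriticalCurve IM IN p L (gyroscopicForce IM β) a b
          (fun t => (γ t).proj)) :=
  ⟨fun _ hm => solves_of_isConstrainedCriticalCurve hL hβ hab hm,
    fun _ hγ hlift => isConstrainedCriticalCurve_of_solves hL hβ hab hγ hlift⟩
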